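/- Let $d\in\mathbb{N}$, let $X=\prod_{i=1}^d[\ell_i,h_i]\subset\mathbb{R}^d$ be a hyperrectangle with $\ell_i<h_i$ for all $i$, let $t_0<t_1$ and $\varepsilon>0$. Let $b(t,x)\in\mathbb{R}^d$ be a vector field that is continuous on $[t_0,t_1]\times X$, locally Lipschitz in $x\in X$ for every $t\in[t_0,t_1]$, and divergence free, i.e. $\sum_i\partial_{x_i}b_i(t,x)=0$ for almost every $x\in X$ and every $t\in[t_0,t_1]$. Consider the Fokker–Planck equation $$\partial_t u=\tfrac{\varepsilon^2}{2}\Delta u-\operatorname{div}(u\,b)\quad\text{on }[t_0,t_1]\times X$$ with one of the following boundary conditions: (i) periodic boundary conditions, where $b(t,\cdot)$ is $X$-periodic (period $h_i-\ell_i$ in $x_i$); or (ii) homogeneous Neumann boundary conditions, where $b(t,\cdot)$ is tangential to $\partial X$ ($b_i(t,x)=0$ whenever $x_i\in\{\ell_i,h_i\}$). Let $V=H^1_{\mathrm{per}}(X)$ in case (i) and $V=H^1(X)$ in case (ii). For $u_0\in L^2(X)$ (real-valued) a weak solution is a function $u\in C([t_0,t_1];L^2(X))\cap L^2(t_0,t_1;V)$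 with $u(t_0)=u_0$ and $$\int_X u(t)\varphi=\int_X u_0\varphi+\int_{t_0}^t\Big(-\tfrac{\varepsilon^2}{2}\int_X\nabla u(s)\cdot\nabla\varphi+\int_X u(s)\,b(s,\cdot)\cdot\nabla\varphi\Big)ds$$ for all $t\in[t_0,t_1]$ and all test functions $\varphi$ (smooth and $X$-periodic in case (i), smooth up to the boundary in case (ii)). Then there is a unique bounded linear operator $\mathcal{P}^\varepsilon:L^2(X)\to L^2(X)$ such that for every $u_0\in L^2(X)$ a weak solution exists and every weak solution $u$ satisfies $u(t_1)=\mathcal{P}^\varepsilon u_0$. The leading singular value $\sigma_1=1$ of $\mathcal{P}^\varepsilon$ is isolated and simple. In detail, with a singular value of $\mathcal{P}^\varepsilon$ being a number $\sigma\ge0$ such that $\sigma^2$ is an eigenvalue of $\mathcal{P}^{\varepsilon,*}\mathcal{P}^\varepsilon$: 1. $1$ is a singular value of $\mathcal{P}^\varepsilon$, every singular value is at most $1$, and $1$ is an isolated point of the set of singular values. 2. $1$ is the largest element, and an isolated point, of the spectrum of $\mathcal{P}^{\varepsilon,*}\mathcal{P}^\varepsilon$; it is a simple eigenvalue of $\mathcal{P}^{\varepsilon,*}\mathcal{P}^\varepsilon$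 whose eigenspace consists of the constant functions. 3. The eigenspace of $\mathcal{P}^\varepsilon$ for the eigenvalue $1$ and the eigenspace of $\mathcal{P}^{\varepsilon,*}$ for the eigenvalue $1$ both consist of the constant functions. 4. $\|\mathcal{P}^\varepsilon u_0\|_{2}<\|u_0\|_{2}$ for every $u_0\in L^2(X)$ that is not (almost everywhere) constant. -/

import Mathlib

open MeasureTheory Set
open scoped ContDiff

noncomputable section

namespace FokkerPlanck

/-- Lebesgue measure on the hyperrectangle `X = ∏ i, [lo i, hi i]`. -/
abbrev boxMeasure {d : ℕ} (lo hi : Fin d → ℝ) : Measure (Fin d → ℝ) :=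
  volume.restrict (Icc lo hi)

instance {d : ℕ} (lo hi : Fin d → ℝ) : IsFiniteMeasure (boxMeasure lo hi) :=
  ⟨by rw [Measure.restrict_apply_univ]; exact isCompact_Icc.measure_lt_top⟩

/-- The real Hilbert space `L²(X)`. -/
abbrev L2 {d : ℕ} (lo hi : Fin d → ℝ) : Type :=
  Lp ℝ 2 (boxMeasure lo hi)

/-- The constant function `1_X` in `L²(X)`. -/
def one {d : ℕ} (lo hi : Fin d → ℝ) : L2 lo hi :=
  Lp.const 2 (boxMeasure lo hi) (1 : ℝ)

/-- The two boundary conditions considered on `∂X`. -/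
inductive BoundaryCondition where
  | periodic
  | neumann

/-- The partial derivative `∂f/∂xᵢ`. -/
def partialDeriv {d : ℕ} (i : Fin d) (f : (Fin d → ℝ) → ℝ) (x : Fin d → ℝ) : ℝ :=
  fderiv ℝ f x (Pi.single i 1)

/-- Periodicity with period `hi i - lo i` in the `i`-th coordinate, for every `i`. -/
def IsBoxPeriodic {d : ℕ} {E : Type*} (lo hi : Fin d → ℝ) (f : (Fin d → ℝ) → E) : Prop :=
  ∀ (i : Fin d) (x : Fin d → ℝ), f (x + Pi.single i (hi i - lo i)) = f x

/-- Spatial test functions: smooth periodic functions for periodic boundary conditions;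
functions smooth up to the boundary, with no condition on `∂X`, for Neumann conditions
(which are natural boundary conditions of the weak formulation). -/
def IsTestFunction {d : ℕ} (lo hi : Fin d → ℝ) :
    BoundaryCondition → ((Fin d → ℝ) → ℝ) → Prop
  | .periodic, φ => ContDiff ℝ ∞ φ ∧ IsBoxPeriodic lo hi φ
  | .neumann, φ => ContDiff ℝ ∞ φ

/-- `u` belongs to the Sobolev space `V` of the boundary condition and has gradient `g`, where `V`
is the closure of the test functions in the `H¹` norm: `V = H¹_per(X)` for periodic boundary
conditions, `V = H¹(X)` for Neumann boundary conditions. -/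
def HasSobolevGradient {d : ℕ} (lo hi : Fin d → ℝ) (bc : BoundaryCondition)
    (u : L2 lo hi) (g : Fin d → L2 lo hi) : Prop :=
  (u, g) ∈ closure {p : L2 lo hi × (Fin d → L2 lo hi) |
    ∃ φ : (Fin d → ℝ) → ℝ, IsTestFunction lo hi bc φ ∧
      p.1 =ᵐ[boxMeasure lo hi] φ ∧
      ∀ i, p.2 i =ᵐ[boxMeasure lo hi] partialDeriv i φ}

/-- What the field must satisfy on `∂X`: it is periodic, or, for Neumann conditions, tangential to
the faces of `X` (`b · n = 0`). -/
def FieldBoundary {d : ℕ} (lo hi : Fin d → ℝ) :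
    BoundaryCondition → ((Fin d → ℝ) → (Fin d → ℝ)) → Prop
  | .periodic, v => IsBoxPeriodic lo hi v
  | .neumann, v => ∀ x ∈ Icc lo hi, ∀ i, x i = lo i ∨ x i = hi i → v x i = 0

/-- The assumptions on the time-dependent vector field `b`: continuous, locally Lipschitz in `x`,
divergence free (a locally Lipschitz field is differentiable almost everywhere), and compatible
with the boundary condition. -/
structure IsAdmissibleField {d : ℕ} (lo hi : Fin d → ℝ) (bc : BoundaryCondition) (t₀ t₁ : ℝ)
    (b : ℝ → (Fin d → ℝ) → (Fin d → ℝ)) : Prop where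
  continuousOn : ContinuousOn (Function.uncurry b) (Icc t₀ t₁ ×ˢ Icc lo hi)
  locallyLipschitzOn : ∀ t ∈ Icc t₀ t₁, LocallyLipschitzOn (Icc lo hi) (b t)
  div_eq_zero : ∀ t ∈ Icc t₀ t₁, ∀ᵐ x ∂(boxMeasure lo hi),
    ∑ i, partialDeriv i (fun y => b t y i) x = 0
  boundary : ∀ t ∈ Icc t₀ t₁, FieldBoundary lo hi bc (b t)

/-- `u` is the weak solution on `[t₀, t₁]` of `∂ₜu = (ε²/2) Δu - div (u b)` with the given boundary
condition and `u(t₀) = u₀`: `u ∈ C([t₀, t₁]; L²(X)) ∩ L²(t₀, t₁; V)` and, for all test functions `φ`,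
`d/dt ⟨u, φ⟩ = -(ε²/2) ∫ ∇u · ∇φ + ∫ u b · ∇φ`, in time-integrated form. -/
def IsWeakSolution {d : ℕ} (lo hi : Fin d → ℝ) (bc : BoundaryCondition) (t₀ t₁ ε : ℝ)
    (b : ℝ → (Fin d → ℝ) → (Fin d → ℝ)) (u₀ : L2 lo hi) (u : ℝ → L2 lo hi) : Prop :=
  ContinuousOn u (Icc t₀ t₁) ∧ u t₀ = u₀ ∧
  ∃ g : ℝ → Fin d → L2 lo hi,
    (∀ i, MemLp (fun s => g s i) 2 (volume.restrict (Icc t₀ t₁))) ∧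
    (∀ᵐ s ∂(volume.restrict (Icc t₀ t₁)), HasSobolevGradient lo hi bc (u s) (g s)) ∧
    ∀ φ : (Fin d → ℝ) → ℝ, IsTestFunction lo hi bc φ → ∀ t ∈ Icc t₀ t₁,
      ∫ x in Icc lo hi, u t x * φ x = (∫ x in Icc lo hi, u₀ x * φ x) +
        ∫ s in t₀..t,
          (-(ε ^ 2 / 2) * (∑ i, ∫ x in Icc lo hi, g s i x * partialDeriv i φ x) +
            ∫ x in Icc lo hi, u s x * ∑ i, b s x i * partialDeriv i φ x)

/-- `P` is the transfer operator `u₀ ↦ u(t₁)`: for every `u₀ ∈ L²(X)` the initial value problem has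
a weak solution, and `P u₀` is the value at time `t₁` of every such solution. -/
def IsTransferOperator {d : ℕ} (lo hi : Fin d → ℝ) (bc : BoundaryCondition) (t₀ t₁ ε : ℝ)
    (b : ℝ → (Fin d → ℝ) → (Fin d → ℝ)) (P : L2 lo hi →L[ℝ] L2 lo hi) : Prop :=
  ∀ u₀ : L2 lo hi, (∃ u, IsWeakSolution lo hi bc t₀ t₁ ε b u₀ u) ∧
    ∀ u, IsWeakSolution lo hi bc t₀ t₁ ε b u₀ u → u t₁ = P u₀

/-- `σ ≥ 0` is a singular value of `T` if `σ²` is an eigenvalue of `T* T`. -/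
def IsSingularValue {H : Type*} [NormedAddCommGroup H] [InnerProductSpace ℝ H] [CompleteSpace H]
    (T : H →L[ℝ] H) (σ : ℝ) : Prop :=
  0 ≤ σ ∧ Module.End.HasEigenvalue
    (ContinuousLinearMap.adjoint T ∘L T : H →L[ℝ] H).toLinearMap (σ ^ 2)

end FokkerPlanck

end

/-! Write `H` for `L²(X)`, `ι : V → H` for the embedding and `κ = ε²/2`. Identifying the dual of `V`
with `V` by Riesz, the weak equation becomes `ι† u(t) = ι† u₀ - ∫ a(s) U(s) ds` in `V`, with `u = ι
U` almost everywhere. Since `b` is divergence free and compatible with the boundary, `∫ u b · ∇u =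
0`, so that `⟪a(t) v, v⟫ = κ ‖∇v‖²`. Hence the energy identity `‖u(t)‖² = ‖u₀‖² - 2κ ∫ ‖∇u‖²`
(`IsEvolution.norm_sq_eq`), which gives uniqueness and contractivity.

Existence (`exists_isEvolution`) is Lions' projection argument: an a priori estimate for the
backward adjoint problem, then Hahn–Banach and Riesz. The resolvents `(ι†ι + δ)⁻¹` serve as
mollifiers, both in the energy identity and in constructing the representative in `C([t₀, t₁]; H)`.

Constants are stationary, so `P 1 = 1`. Mass is conserved, so `P* 1 = 1`, and zero mean persists.
For zero mean, Poincaré and the energy identity give `(1 + c) ‖u(t₁)‖² ≤ ‖u₀‖²` with `c > 0`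
independent of `u₀` (`exists_contraction`). So `P` contracts the complement of the constants by a
factor `q < 1`.

Every spectral claim follows from this alone (`IsGapped`): `P*` and `P* P` inherit the structure,
and the spectrum of such an operator lies in `(-∞, q] ∪ {1}`. No compactness of `P` is used. -/

namespace FokkerPlanck
open ContinuousLinearMap
open scoped InnerProductSpace

/-! ### Operators that contract the complement of a fixed vector. -/

section SpectralGap

variable {H : Type*} [NormedAddCommGroup H] [InnerProductSpace ℝ H]

theorem exists_add_smul_of_ne_zero {e : H} (he : e ≠ 0) (x : H) :
    ∃ v : H, ∃ c : ℝ, ⟪e, v⟫_ℝ = 0 ∧ x = v + c • e := by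
  refine ⟨x - (⟪e, x⟫_ℝ / ⟪e, e⟫_ℝ) • e, ⟪e, x⟫_ℝ / ⟪e, e⟫_ℝ, ?_, by abel⟩
  have : ⟪e, e⟫_ℝ ≠ 0 := inner_self_ne_zero.mpr he
  rw [inner_sub_right, inner_smul_right]
  field_simp
  ring

theorem mem_spectrum_of_hasEigenvalue {T : H →L[ℝ] H} {μ : ℝ}
    (hμ : Module.End.HasEigenvalue T.toLinearMap μ) : μ ∈ spectrum ℝ T := by
  obtain ⟨x, hx⟩ := hμ.exists_hasEigenvector
  intro hu
  obtain ⟨w, hw⟩ := hu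
  refine hx.2 ?_
  have h1 : (algebraMap ℝ (H →L[ℝ] H) μ - T) x = 0 := by
    have : T x = μ • x := hx.apply_eq_smul
    simp [Algebra.algebraMap_eq_smul_one, this]
  have h2 : (w⁻¹.val * w.val) x = x := by rw [Units.inv_mul]; rfl
  rw [hw] at h2
  change w⁻¹.val ((algebraMap ℝ (H →L[ℝ] H) μ - T) x) = x at h2
  rw [h1, map_zero] at h2
  exact h2.symm

variable [CompleteSpace H]

/-- A bounded operator which fixes `e`, whose adjoint fixes `e`, and which is a strict contraction
on the orthogonal complement of `e`. -/
structure IsGapped (P : H →L[ℝ] H) (e : H) (q : ℝ) : Prop where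
  ne_zero : e ≠ 0
  map_self : P e = e
  adjoint_map_self : adjoint P e = e
  nonneg : 0 ≤ q
  lt_one : q < 1
  norm_le : ∀ v, ⟪e, v⟫_ℝ = 0 → ‖P v‖ ≤ q * ‖v‖

namespace IsGapped

variable {P : H →L[ℝ] H} {e : H} {q : ℝ}

theorem inner_map (h : IsGapped P e q) (v : H) : ⟪e, P v⟫_ℝ = ⟪e, v⟫_ℝ := by
  rw [← adjoint_inner_left, h.adjoint_map_self]

/-- `P*` preserves the complement of `e` because `P` fixes `e`; there `‖P* v‖² = ⟪v, P P* v⟫ ≤ ‖v‖ q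
‖P* v‖`, so the constant is the same. -/
theorem adjoint (h : IsGapped P e q) : IsGapped (adjoint P) e q where
  ne_zero := h.ne_zero
  map_self := h.adjoint_map_self
  adjoint_map_self := by rw [adjoint_adjoint, h.map_self]
  nonneg := h.nonneg
  lt_one := h.lt_one
  norm_le v hv := by
    have h1 : ⟪e, ContinuousLinearMap.adjoint P v⟫_ℝ = 0 := by
      rw [adjoint_inner_right, h.map_self, hv]
    have h2 : ‖ContinuousLinearMap.adjoint P v‖ * ‖ContinuousLinearMap.adjoint P v‖ ≤
        (q * ‖v‖) * ‖ContinuousLinearMap.adjoint P v‖ := by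
      rw [← real_inner_self_eq_norm_mul_norm, adjoint_inner_left]
      calc _ ≤ ‖v‖ * ‖P (ContinuousLinearMap.adjoint P v)‖ := real_inner_le_norm _ _
        _ ≤ ‖v‖ * (q * ‖ContinuousLinearMap.adjoint P v‖) := by gcongr; exact h.norm_le _ h1
        _ = _ := by ring
    rcases (norm_nonneg (ContinuousLinearMap.adjoint P v)).eq_or_lt with h0 | h0
    · rw [← h0]; exact mul_nonneg h.nonneg (norm_nonneg _)
    · exact le_of_mul_le_mul_right h2 h0

theorem comp {Q : H →L[ℝ] H} (hQ : IsGapped Q e q) (h : IsGapped P e q) :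
    IsGapped (Q ∘L P) e (q ^ 2) where
  ne_zero := h.ne_zero
  map_self := by simp [h.map_self, hQ.map_self]
  adjoint_map_self := by simp [adjoint_comp, h.adjoint_map_self, hQ.adjoint_map_self]
  nonneg := by positivity
  lt_one := by nlinarith [h.nonneg, h.lt_one]
  norm_le v hv := by
    have h1 := hQ.norm_le (P v) (by rw [h.inner_map, hv])
    have h2 := h.norm_le v hv
    calc ‖(Q ∘L P) v‖ ≤ q * ‖P v‖ := h1
      _ ≤ q * (q * ‖v‖) := by gcongr; exact h.nonneg
      _ = _ := by ring

/-- The component of a fixed vector orthogonal to `e` is itself fixed, and the contraction forces it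
to vanish. -/
theorem eigenspace_one (h : IsGapped P e q) :
    Module.End.eigenspace P.toLinearMap 1 = Submodule.span ℝ {e} := by
  ext x
  rw [Module.End.mem_eigenspace_iff, one_smul, Submodule.mem_span_singleton]
  constructor
  · intro hx
    obtain ⟨v, c, hv, rfl⟩ := exists_add_smul_of_ne_zero h.ne_zero x
    have h1 : P v = v := by
      have : P (v + c • e) = v + c • e := hx
      rw [map_add, map_smul, h.map_self] at this
      exact add_right_cancel this
    have h2 := h.norm_le v hv
    rw [h1] at h2
    have h3 : ‖v‖ = 0 := by nlinarith [norm_nonneg v, h.lt_one]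
    exact ⟨c, by rw [norm_eq_zero.mp h3, zero_add]⟩
  · rintro ⟨c, rfl⟩
    change P (c • e) = c • e
    rw [map_smul, h.map_self]

/-- Pythagoras: since `P* e = e`, the image of `v` stays orthogonal to `e`. -/
theorem norm_sq_le (h : IsGapped P e q) {v : H} (hv : ⟪e, v⟫_ℝ = 0) (c : ℝ) :
    ‖P (v + c • e)‖ ^ 2 ≤ (q * ‖v‖) ^ 2 + ‖c • e‖ ^ 2 := by
  have h1 : ⟪P v, c • e⟫_ℝ = 0 := by
    rw [inner_smul_right, real_inner_comm, h.inner_map, hv, mul_zero]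
  have h2 := norm_add_sq_eq_norm_sq_add_norm_sq_real h1
  rw [map_add, map_smul, h.map_self, sq, h2, ← sq, ← sq]
  gcongr
  exact h.norm_le v hv

theorem norm_map_lt (h : IsGapped P e q) {x : H} (hx : x ∉ Submodule.span ℝ {e}) :
    ‖P x‖ < ‖x‖ := by
  obtain ⟨v, c, hv, rfl⟩ := exists_add_smul_of_ne_zero h.ne_zero x
  have hv0 : v ≠ 0 := by
    rintro rfl
    exact hx (Submodule.mem_span_singleton.mpr ⟨c, by simp⟩)
  have h1 : ⟪v, c • e⟫_ℝ = 0 := by rw [inner_smul_right, real_inner_comm, hv, mul_zero]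
  have h2 := norm_add_sq_eq_norm_sq_add_norm_sq_real h1
  have h3 := h.norm_sq_le hv c
  have h4 : 0 < ‖v‖ := norm_pos_iff.mpr hv0
  have h5 : q * ‖v‖ < ‖v‖ := by nlinarith [h.lt_one]
  have h6 : (q * ‖v‖) ^ 2 < ‖v‖ ^ 2 := by
    have := mul_nonneg h.nonneg h4.le
    gcongr
  nlinarith [norm_nonneg (P (v + c • e)), norm_nonneg (v + c • e)]

/-- The spectrum of a gapped operator is contained in `(-∞, q] ∪ {1}`. -/
theorem eq_one_or_le_of_mem_spectrum (h : IsGapped P e q) {μ : ℝ} (hμ : μ ∈ spectrum ℝ P) :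
    μ = 1 ∨ μ ≤ q := by
  by_contra! hcon
  obtain ⟨h1, h2⟩ := hcon
  have hμ0 : 0 < μ := h.nonneg.trans_lt h2
  have hee : ⟪e, e⟫_ℝ ≠ 0 := inner_self_ne_zero.mpr h.ne_zero
  -- the orthogonal projection onto the line spanned by `e`
  let π : H →L[ℝ] H := (innerSL ℝ e).smulRight ((⟪e, e⟫_ℝ)⁻¹ • e)
  have hπ (x : H) : π x = (⟪e, x⟫_ℝ * (⟪e, e⟫_ℝ)⁻¹) • e := by
    simp [π, smul_smul]
  have hort (x : H) : ⟪e, x - π x⟫_ℝ = 0 := by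
    rw [inner_sub_right, hπ, inner_smul_right]; field_simp; ring
  have hmul (A B : H →L[ℝ] H) (x : H) : (A * B) x = A (B x) := rfl
  have hππ : π * π = π := by
    ext x; simp only [hmul, hπ, inner_smul_right]; congr 1; field_simp
  have hPπ : P * π = π := by ext x; simp only [hmul, hπ, map_smul, h.map_self]
  have hπP : π * P = π := by ext x; simp only [hmul, hπ, h.inner_map]
  have hnorm (x : H) : ‖x - π x‖ ≤ ‖x‖ := by
    have h3 : ⟪x - π x, π x⟫_ℝ = 0 := by
      obtain ⟨c, hc⟩ : ∃ c : ℝ, π x = c • e := ⟨_, hπ x⟩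
      have h4 := hort x
      rw [hc] at h4 ⊢
      rw [inner_smul_right, real_inner_comm, h4, mul_zero]
    have h4 := norm_add_sq_eq_norm_sq_add_norm_sq_real h3
    rw [sub_add_cancel] at h4
    nlinarith [norm_nonneg x, norm_nonneg (x - π x), norm_nonneg (π x)]
  -- Removing the projection leaves an operator of norm at most `q < μ`, so `μ - (P - π)` is
  -- invertible.
  have hA : ‖P - π‖ ≤ q := by
    refine opNorm_le_bound _ h.nonneg fun x => ?_
    have : (P - π) x = P (x - π x) := by
      rw [map_sub, sub_apply]; congr 1; exact (DFunLike.congr_fun hPπ x).symm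
    rw [this]
    exact (h.norm_le _ (hort x)).trans (by gcongr; exacts [h.nonneg, hnorm x])
  have hu1 : IsUnit (algebraMap ℝ (H →L[ℝ] H) μ - (P - π)) := by
    by_contra hcon
    have h4 := spectrum.norm_le_norm_mul_of_mem (𝕜 := ℝ) (k := μ) (a := P - π) hcon
    have h5 : ‖(1 : H →L[ℝ] H)‖ ≤ 1 := norm_id_le
    rw [Real.norm_of_nonneg hμ0.le] at h4
    nlinarith [norm_nonneg (P - π)]
  -- As `π` is idempotent and `μ ≠ 0, 1`, the inverse is explicit.
  have hu2 : IsUnit (algebraMap ℝ (H →L[ℝ] H) μ - π) := by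
    have h1' : μ - 1 ≠ 0 := sub_ne_zero.mpr h1
    refine ⟨⟨_, μ⁻¹ • (1 + (μ - 1)⁻¹ • π), ?_, ?_⟩, rfl⟩ <;>
    · simp only [Algebra.algebraMap_eq_smul_one, sub_mul, mul_sub, smul_mul_assoc, mul_smul_comm,
        one_mul, mul_one, mul_add, add_mul, hππ]
      match_scalars <;> field_simp
      ring
  -- The factorization works because `P π = π = π π`; two invertible factors then make `μ - P`
  -- invertible.
  have hu3 : (algebraMap ℝ (H →L[ℝ] H) μ - (P - π)) * (algebraMap ℝ (H →L[ℝ] H) μ - π) =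
      μ • (algebraMap ℝ (H →L[ℝ] H) μ - P) := by
    simp only [Algebra.algebraMap_eq_smul_one, sub_mul, mul_sub, smul_mul_assoc, mul_smul_comm,
        one_mul, mul_one, hππ, hPπ, smul_sub]
    abel
  have hu4 : IsUnit (μ • (algebraMap ℝ (H →L[ℝ] H) μ - P)) := hu3 ▸ hu1.mul hu2
  have hu5 : IsUnit (algebraMap ℝ (H →L[ℝ] H) μ - P) := by
    have := hu4.smul (Units.mk0 μ hμ0.ne')⁻¹
    rwa [Units.smul_def, smul_smul, Units.val_inv_eq_inv_val, Units.val_mk0,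
      inv_mul_cancel₀ hμ0.ne', one_smul] at this
  exact hμ hu5

theorem hasEigenvalue_one (h : IsGapped P e q) :
    Module.End.HasEigenvalue P.toLinearMap 1 := by
  refine Module.End.hasEigenvalue_of_hasEigenvector (x := e) ⟨?_, h.ne_zero⟩
  change e ∈ Module.End.eigenspace P.toLinearMap 1
  rw [h.eigenspace_one]
  exact Submodule.mem_span_singleton_self e

theorem finrank_eigenspace (h : IsGapped P e q) :
    Module.finrank ℝ (Module.End.eigenspace P.toLinearMap 1) = 1 := by
  rw [h.eigenspace_one, finrank_span_singleton h.ne_zero]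

theorem isGreatest_spectrum (h : IsGapped P e q) : IsGreatest (spectrum ℝ P) 1 :=
  ⟨mem_spectrum_of_hasEigenvalue h.hasEigenvalue_one, fun μ hμ => by
    rcases h.eq_one_or_le_of_mem_spectrum hμ with h1 | h1
    · exact h1.le
    · exact h1.trans h.lt_one.le⟩

theorem spectrum_gap (h : IsGapped P e q) :
    ∀ μ ∈ spectrum ℝ P, μ ≠ 1 → 1 - q ≤ |μ - 1| := by
  intro μ hμ hne
  have h1 := (h.eq_one_or_le_of_mem_spectrum hμ).resolve_left hne
  rw [abs_sub_comm]
  exact (by linarith : 1 - q ≤ 1 - μ).trans (le_abs_self _)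

/-- Transfers every statement on the eigenvalue `1` and the spectral gap to `P* P`, hence to
singular values. -/
theorem adjoint_comp_self (h : IsGapped P e q) :
    IsGapped (ContinuousLinearMap.adjoint P ∘L P) e (q ^ 2) := h.adjoint.comp h

theorem isSingularValue_one (h : IsGapped P e q) : IsSingularValue P 1 :=
  ⟨zero_le_one, by rw [one_pow]; exact h.adjoint_comp_self.hasEigenvalue_one⟩

theorem eq_one_or_le_of_isSingularValue (h : IsGapped P e q) {σ : ℝ} (hσ : IsSingularValue P σ) :
    σ = 1 ∨ σ ≤ q := by
  rcases h.adjoint_comp_self.eq_one_or_le_of_mem_spectrum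
    (mem_spectrum_of_hasEigenvalue hσ.2) with h1 | h1
  · left; exact (pow_eq_one_iff_of_nonneg hσ.1 two_ne_zero).mp h1
  · right; exact le_of_sq_le_sq h1 h.nonneg

end IsGapped

end SpectralGap

end FokkerPlanck

namespace FokkerPlanck
open ContinuousLinearMap Filter
open scoped InnerProductSpace Topology

/-! ### Product rule for primitives and smoothing by resolvents. -/

section Resolvent

/-- Increments split as in the product rule, and absolutely continuous curves are bounded on the
interval. -/
theorem _root_.AbsolutelyContinuousOnInterval.inner {E : Type*} [NormedAddCommGroup E]
    [InnerProductSpace ℝ E] {f g : ℝ → E} {a b : ℝ}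
    (hf : AbsolutelyContinuousOnInterval f a b) (hg : AbsolutelyContinuousOnInterval g a b) :
    AbsolutelyContinuousOnInterval (fun s => ⟪f s, g s⟫_ℝ) a b := by
  obtain ⟨C, hC⟩ := hf.exists_bound
  obtain ⟨D, hD⟩ := hg.exists_bound
  unfold AbsolutelyContinuousOnInterval at hf hg
  apply squeeze_zero' ?_ ?_
    (by simpa using (hg.const_mul C).add (hf.const_mul D))
  · exact Filter.Eventually.of_forall <| fun _ ↦ Finset.sum_nonneg (fun i hi ↦ dist_nonneg)
  rw [eventually_inf_principal]
  filter_upwards with (n, I) hnI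
  simp only [Finset.mul_sum, ← Finset.sum_add_distrib]
  gcongr with i hi
  have h1 := hC _ (hnI.left i hi |>.left)
  have h2 := hD _ (hnI.left i hi |>.right)
  have h3 : ⟪f (I i).1, g (I i).1⟫_ℝ - ⟪f (I i).2, g (I i).2⟫_ℝ =
      ⟪f (I i).1, g (I i).1 - g (I i).2⟫_ℝ + ⟪f (I i).1 - f (I i).2, g (I i).2⟫_ℝ := by
    rw [inner_sub_right, inner_sub_left]; ring
  rw [Real.dist_eq, h3, dist_eq_norm, dist_eq_norm]
  calc _ ≤ ‖f (I i).1‖ * ‖g (I i).1 - g (I i).2‖ + ‖f (I i).1 - f (I i).2‖ * ‖g (I i).2‖ :=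
        (abs_add_le _ _).trans (add_le_add (abs_real_inner_le_norm _ _) (abs_real_inner_le_norm _ _))
    _ ≤ _ := by
        rw [mul_comm D]
        gcongr

/-- Increments are dominated by those of the scalar primitive of `‖f‖`. -/
theorem absolutelyContinuousOnInterval_primitive {E : Type*} [NormedAddCommGroup E]
    [NormedSpace ℝ E] {a b : ℝ} {f : ℝ → E} (hf : IntervalIntegrable f volume a b) :
    AbsolutelyContinuousOnInterval (fun x => ∫ s in a..x, f s) a b := by
  have h := hf.norm.absolutelyContinuousOnInterval_intervalIntegral (c := a) (by simp)
  unfold AbsolutelyContinuousOnInterval at h ⊢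
  refine squeeze_zero' ?_ ?_ h
  · exact Filter.Eventually.of_forall <| fun _ ↦ Finset.sum_nonneg (fun i hi ↦ dist_nonneg)
  rw [eventually_inf_principal]
  filter_upwards with (n, I) hnI
  gcongr with i hi
  have hsub {x : ℝ} (hx : x ∈ uIcc a b) : IntervalIntegrable f volume a x :=
    hf.mono_set (uIcc_subset_uIcc (by simp) hx)
  have h1 := hsub (hnI.left i hi).left
  have h2 := hsub (hnI.left i hi).right
  rw [dist_eq_norm, dist_eq_norm, intervalIntegral.integral_interval_sub_left h1 h2,
    intervalIntegral.integral_interval_sub_left h1.norm h2.norm]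
  exact intervalIntegral.norm_integral_le_abs_integral_norm

/-- The product rule for the inner product of two primitives. -/
theorem inner_primitive_eq {E : Type*} [NormedAddCommGroup E] [InnerProductSpace ℝ E]
    [CompleteSpace E] {a b : ℝ} {f g : ℝ → E} (hf : IntervalIntegrable f volume a b)
    (hg : IntervalIntegrable g volume a b) (y z : E) :
    ⟪y + ∫ s in a..b, f s, z + ∫ s in a..b, g s⟫_ℝ = ⟪y, z⟫_ℝ +
      ∫ s in a..b, (⟪f s, z + ∫ r in a..s, g r⟫_ℝ + ⟪y + ∫ r in a..s, f r, g s⟫_ℝ) := by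
  have hconst (w : E) : AbsolutelyContinuousOnInterval (fun _ => w) a b :=
    ((LipschitzWith.const w).lipschitzOnWith (s := uIcc a b)).absolutelyContinuousOnInterval
  have h1 := (hconst y).fun_add (absolutelyContinuousOnInterval_primitive hf)
  have h2 := (hconst z).fun_add (absolutelyContinuousOnInterval_primitive hg)
  have h3 := (h1.inner h2).integral_deriv_eq_sub
  simp only [intervalIntegral.integral_same, add_zero] at h3
  rw [← sub_eq_iff_eq_add', ← h3]
  -- Lebesgue differentiation identifies the derivative almost everywhere, which suffices for an
  -- absolutely continuous function.
  apply intervalIntegral.integral_congr_ae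
  filter_upwards [hf.ae_hasDerivAt_integral, hg.ae_hasDerivAt_integral] with x hx1 hx2 hx3
  have hx4 : x ∈ uIcc a b := uIoc_subset_uIcc hx3
  have d1 := (hx1 hx4 a (by simp)).const_add y
  have d2 := (hx2 hx4 a (by simp)).const_add z
  rw [(d1.inner ℝ d2).deriv, add_comm]

variable {H V : Type*} [NormedAddCommGroup H] [InnerProductSpace ℝ H] [CompleteSpace H]
  [NormedAddCommGroup V] [InnerProductSpace ℝ V] [CompleteSpace V]

/-- `G` is the inverse of `ι† ι + δ`. -/
def IsResolvent (ι : V →L[ℝ] H) (δ : ℝ) (G : V →L[ℝ] V) : Prop :=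
  ∀ x, adjoint ι (ι (G x)) + δ • G x = x

/-- Lax–Milgram: the form of `ι† ι + δ` is coercive with constant `δ`. -/
theorem exists_isResolvent (ι : V →L[ℝ] H) {δ : ℝ} (hδ : 0 < δ) : ∃ G, IsResolvent ι δ G := by
  let A : V →L[ℝ] V := adjoint ι ∘L ι + δ • ContinuousLinearMap.id ℝ V
  let B : V →L[ℝ] V →L[ℝ] ℝ := (innerSL ℝ) ∘L A
  have hB (v w : V) : B v w = ⟪A v, w⟫_ℝ := rfl
  have hA (v : V) : A v = adjoint ι (ι v) + δ • v := rfl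
  have hco : IsCoercive B := by
    refine ⟨δ, hδ, fun v => ?_⟩
    rw [hB, hA, inner_add_left, adjoint_inner_left, inner_smul_left,
      real_inner_self_eq_norm_mul_norm, real_inner_self_eq_norm_mul_norm]
    simp only [conj_trivial]
    nlinarith [mul_self_nonneg ‖ι v‖]
  let e := hco.continuousLinearEquivOfBilin
  have he (v : V) : e v = A v := by
    refine ext_inner_right ℝ fun w => ?_
    rw [IsCoercive.continuousLinearEquivOfBilin_apply]
    rfl
  refine ⟨e.symm.toContinuousLinearMap, fun x => ?_⟩
  rw [← hA]
  change A (e.symm x) = x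
  rw [← he, ContinuousLinearEquiv.apply_symm_apply]

namespace IsResolvent

variable {ι : V →L[ℝ] H} {δ : ℝ} {G : V →L[ℝ] V}

theorem inner_map_left (h : IsResolvent ι δ G) (x y : V) : ⟪G x, y⟫_ℝ = ⟪x, G y⟫_ℝ := by
  conv_lhs => rw [← h y]
  conv_rhs => rw [← h x]
  simp only [inner_add_left, inner_add_right, inner_smul_left, inner_smul_right,
    adjoint_inner_left, adjoint_inner_right, conj_trivial]

/-- `IsResolvent` only makes `G` a right inverse; symmetry makes it a left inverse as well. -/
theorem map_add (h : IsResolvent ι δ G) (x : V) : G (adjoint ι (ι x)) + δ • G x = x := by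
  refine ext_inner_right ℝ fun y => ?_
  conv_rhs => rw [← h y]
  simp only [inner_add_left, inner_add_right, inner_smul_left, inner_smul_right,
    adjoint_inner_left, adjoint_inner_right, conj_trivial, h.inner_map_left]

theorem comm (h : IsResolvent ι δ G) (x : V) : G (adjoint ι (ι x)) = adjoint ι (ι (G x)) :=
  add_right_cancel ((h.map_add x).trans (h x).symm)

/-- The two summands of `x` in `map_add` have inner product `δ ‖ι (G x)‖² ≥ 0`. Both resulting
contraction bounds are uniform in `δ`. -/
theorem norm_sq_add_le (h : IsResolvent ι δ G) (hδ : 0 < δ) (x : V) :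
    ‖G (adjoint ι (ι x))‖ ^ 2 + ‖δ • G x‖ ^ 2 ≤ ‖x‖ ^ 2 := by
  conv_rhs => rw [← h.map_add x]
  rw [norm_add_sq_real, h.comm, inner_smul_right, adjoint_inner_left,
    real_inner_self_eq_norm_sq]
  nlinarith [mul_nonneg hδ.le (sq_nonneg ‖ι (G x)‖)]

theorem norm_smul_le (h : IsResolvent ι δ G) (hδ : 0 < δ) (x : V) : ‖δ • G x‖ ≤ ‖x‖ :=
  le_of_sq_le_sq (by nlinarith [h.norm_sq_add_le hδ x, sq_nonneg ‖G (adjoint ι (ι x))‖])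
    (norm_nonneg _)

theorem norm_map_le (h : IsResolvent ι δ G) (hδ : 0 < δ) (x : V) :
    ‖G (adjoint ι (ι x))‖ ≤ ‖x‖ :=
  le_of_sq_le_sq (by nlinarith [h.norm_sq_add_le hδ x, sq_nonneg ‖δ • G x‖]) (norm_nonneg _)

theorem norm_comp_le (h : IsResolvent ι δ G) (hδ : 0 < δ) (f : H) :
    ‖ι (G (adjoint ι f))‖ ≤ ‖f‖ := by
  set r := G (adjoint ι f) with hr
  -- The resolvent equation for `r`, tested with `r` itself.
  have h1 : ‖ι r‖ ^ 2 + δ * ‖r‖ ^ 2 = ⟪f, ι r⟫_ℝ := by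
    have := congrArg (fun v => ⟪v, r⟫_ℝ) (h (adjoint ι f))
    simpa only [← hr, inner_add_left, inner_smul_left, adjoint_inner_left, conj_trivial,
      real_inner_self_eq_norm_sq] using this
  have h2 := real_inner_le_norm f (ι r)
  by_contra! hcon
  have h3 : 0 < ‖ι r‖ := (norm_nonneg f).trans_lt hcon
  nlinarith [mul_nonneg hδ.le (sq_nonneg ‖r‖)]

end IsResolvent

/-- The sequence of resolvents with parameters `1 / (n + 1)`. -/
noncomputable def smoothing (ι : V →L[ℝ] H) (n : ℕ) : V →L[ℝ] V :=
  (exists_isResolvent ι (Nat.one_div_pos_of_nat (α := ℝ) (n := n))).choose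

theorem isResolvent_smoothing (ι : V →L[ℝ] H) (n : ℕ) :
    IsResolvent ι (1 / ((n : ℝ) + 1)) (smoothing ι n) :=
  (exists_isResolvent ι (Nat.one_div_pos_of_nat (α := ℝ) (n := n))).choose_spec

/-- A vector orthogonal to the range satisfies `‖ι v‖² = 0`. -/
theorem denseRange_adjoint_comp_self {ι : V →L[ℝ] H} (hι : Function.Injective ι) :
    DenseRange (fun x => adjoint ι (ι x)) := by
  let A : V →L[ℝ] V := adjoint ι ∘L ι
  have h1 : A.range.topologicalClosure = ⊤ := by
    rw [Submodule.topologicalClosure_eq_top_iff, Submodule.eq_bot_iff]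
    intro v hv
    have h2 : ⟪A v, v⟫_ℝ = 0 := Submodule.inner_right_of_mem_orthogonal (LinearMap.mem_range_self A.toLinearMap v) hv
    change ⟪adjoint ι (ι v), v⟫_ℝ = 0 at h2
    rw [adjoint_inner_left, inner_self_eq_zero] at h2
    exact hι (by rw [h2, _root_.map_zero])
  exact Submodule.dense_iff_topologicalClosure_eq_top.mpr h1

/-- On the dense range of `ι† ι` the norm is at most `δ ‖w‖`; the uniform bound `‖δ G‖ ≤ 1` extends
the limit to all of `V`. -/
theorem tendsto_smul_smoothing {ι : V →L[ℝ] H} (hι : Function.Injective ι) (x : V) :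
    Tendsto (fun n : ℕ => (1 / ((n : ℝ) + 1)) • smoothing ι n x) atTop (𝓝 0) := by
  rw [Metric.tendsto_atTop]
  intro ε hε
  obtain ⟨w, hw⟩ := (denseRange_adjoint_comp_self hι).exists_dist_lt x (half_pos hε)
  have h1 : Tendsto (fun n : ℕ => (1 / ((n : ℝ) + 1)) * ‖w‖) atTop (𝓝 0) := by
    simpa using (tendsto_one_div_add_atTop_nhds_zero_nat (𝕜 := ℝ)).mul_const ‖w‖
  obtain ⟨N, hN⟩ := (Metric.tendsto_atTop.mp h1) (ε / 2) (half_pos hε)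
  refine ⟨N, fun n hn => ?_⟩
  have hδ : (0 : ℝ) < 1 / ((n : ℝ) + 1) := Nat.one_div_pos_of_nat
  have hG := isResolvent_smoothing ι n
  have h2 : x = (x - adjoint ι (ι w)) + adjoint ι (ι w) := by abel
  have h3 := hG.norm_smul_le hδ (x - adjoint ι (ι w))
  have h4 : ‖(1 / ((n : ℝ) + 1)) • smoothing ι n (adjoint ι (ι w))‖ ≤ 1 / ((n : ℝ) + 1) * ‖w‖ := by
    rw [norm_smul, Real.norm_of_nonneg hδ.le]
    gcongr
    exact hG.norm_map_le hδ w
  have h5 := hN n hn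
  rw [Real.dist_eq, sub_zero, abs_of_nonneg (by positivity)] at h5
  rw [dist_eq_norm] at hw
  rw [dist_zero_right, h2, _root_.map_add, smul_add]
  calc _ ≤ _ := norm_add_le _ _
    _ < ε / 2 + ε / 2 := by linarith
    _ = ε := by ring

theorem tendsto_smoothing {ι : V →L[ℝ] H} (hι : Function.Injective ι) (x : V) :
    Tendsto (fun n : ℕ => smoothing ι n (adjoint ι (ι x))) atTop (𝓝 x) := by
  have h := (tendsto_smul_smoothing hι x).const_sub x
  rw [sub_zero] at h
  refine h.congr fun n => ?_
  rw [sub_eq_iff_eq_add]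
  exact ((isResolvent_smoothing ι n).map_add x).symm

theorem tendsto_comp_smoothing {ι : V →L[ℝ] H} (hι : Function.Injective ι) (hd : DenseRange ι)
    (f : H) : Tendsto (fun n : ℕ => ι (smoothing ι n (adjoint ι f))) atTop (𝓝 f) := by
  rw [Metric.tendsto_atTop]
  intro ε hε
  obtain ⟨w, hw⟩ := hd.exists_dist_lt f (by positivity : 0 < ε / 3)
  have h1 := (ι.continuous.tendsto w).comp (tendsto_smoothing hι w)
  obtain ⟨N, hN⟩ := (Metric.tendsto_atTop.mp h1) (ε / 3) (by positivity)
  refine ⟨N, fun n hn => ?_⟩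
  have h2 := (isResolvent_smoothing ι n).norm_comp_le Nat.one_div_pos_of_nat (f - ι w)
  have h3 := hN n hn
  simp only [Function.comp_apply] at h3
  have h4 : dist (ι (smoothing ι n (adjoint ι f))) (ι (smoothing ι n (adjoint ι (ι w)))) ≤
      dist f (ι w) := by
    rw [dist_eq_norm, dist_eq_norm, ← map_sub, ← map_sub, ← map_sub]; exact h2
  have h5 := dist_triangle4 (ι (smoothing ι n (adjoint ι f)))
    (ι (smoothing ι n (adjoint ι (ι w)))) (ι w) f
  rw [dist_comm (ι w) f] at h5
  linarith

theorem norm_smoothing_comp_sub_le (ι : V →L[ℝ] H) (n : ℕ) (x : V) :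
    ‖smoothing ι n (adjoint ι (ι x)) - x‖ ≤ ‖x‖ := by
  have h := (isResolvent_smoothing ι n).norm_smul_le Nat.one_div_pos_of_nat x
  have h1 : (1 / ((n : ℝ) + 1)) • smoothing ι n x = x - smoothing ι n (adjoint ι (ι x)) :=
    eq_sub_of_add_eq' ((isResolvent_smoothing ι n).map_add x)
  rwa [h1, norm_sub_rev] at h

end Resolvent

end FokkerPlanck

namespace FokkerPlanck
open ContinuousLinearMap Filter
open scoped InnerProductSpace Topology

/-! ### Abstract evolution equations: energy identity and Lions' representation lemma. -/

section Evolution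

variable {H V : Type*} [NormedAddCommGroup H] [InnerProductSpace ℝ H] [CompleteSpace H]
  [NormedAddCommGroup V] [InnerProductSpace ℝ V] [CompleteSpace V]

/-- `u ∈ C([t₀, t₁]; H)` with `u = ι U` almost everywhere, `U ∈ L²(t₀, t₁; V)`, solves
`∂ₜ u = - a(t) u`, `u(t₀) = u₀` in the dual of `V`, in time-integrated form. -/
structure IsEvolution (ι : V →L[ℝ] H) (a : ℝ → V →L[ℝ] V) (t₀ t₁ : ℝ) (u₀ : H) (u : ℝ → H)
    (U : ℝ → V) : Prop where
  continuousOn : ContinuousOn u (Icc t₀ t₁)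
  memLp : MemLp U 2 (volume.restrict (Icc t₀ t₁))
  ae_eq : ∀ᵐ s ∂(volume.restrict (Icc t₀ t₁)), u s = ι (U s)
  eq_integral : ∀ t ∈ Icc t₀ t₁, adjoint ι (u t) = adjoint ι u₀ - ∫ s in t₀..t, a s (U s)

variable {ι : V →L[ℝ] H} {a : ℝ → V →L[ℝ] V} {t₀ t₁ κ : ℝ}

theorem intervalIntegrable_of_integrable_restrict {E : Type*} [NormedAddCommGroup E] {f : ℝ → E}
    (hf : Integrable f (volume.restrict (Icc t₀ t₁))) {t : ℝ} (ht : t ∈ Icc t₀ t₁) :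
    IntervalIntegrable f volume t₀ t := by
  rw [intervalIntegrable_iff_integrableOn_Icc_of_le ht.1]
  exact IntegrableOn.mono_set hf (Icc_subset_Icc_right ht.2)

theorem intervalIntegrable_of_memLp {E : Type*} [NormedAddCommGroup E] {f : ℝ → E}
    (hf : MemLp f 2 (volume.restrict (Icc t₀ t₁))) {t : ℝ} (ht : t ∈ Icc t₀ t₁) :
    IntervalIntegrable f volume t₀ t :=
  intervalIntegrable_of_integrable_restrict (hf.integrable one_le_two) ht

theorem memLp_clm_apply {V : Type*} [NormedAddCommGroup V] [NormedSpace ℝ V]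
    {a : ℝ → V →L[ℝ] V} (ha : ContinuousOn a (Icc t₀ t₁)) {U : ℝ → V}
    (hU : MemLp U 2 (volume.restrict (Icc t₀ t₁))) :
    MemLp (fun s => a s (U s)) 2 (volume.restrict (Icc t₀ t₁)) := by
  obtain ⟨C, hC⟩ := isCompact_Icc.exists_bound_of_continuousOn ha
  refine hU.of_le_mul (c := C) ?_ ?_
  · exact (isBoundedBilinearMap_apply (𝕜 := ℝ) (E := V) (F := V)).continuous.comp_aestronglyMeasurable
      ((ha.aestronglyMeasurable_of_isCompact isCompact_Icc measurableSet_Icc).prodMk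
        hU.aestronglyMeasurable)
  · filter_upwards [ae_restrict_mem measurableSet_Icc] with s hs
    exact ((a s).le_opNorm _).trans (by gcongr; exact hC s hs)

/-- The equation controls `ι† u` in `V`, not `u` in `H`; applying `ι C` to this primitive gives a
curve in `H` to which the product rule applies. Used with one resolvent for the energy identity and
with a difference of two for the Cauchy estimate. -/
theorem norm_sq_comp_primitive {C : V →L[ℝ] V} (hC : ∀ x y, ⟪C x, y⟫_ℝ = ⟪x, C y⟫_ℝ) {F : ℝ → V}
    {t : ℝ} (hF : IntervalIntegrable F volume t₀ t) (z : V) :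
    ‖ι (C (z - ∫ s in t₀..t, F s))‖ ^ 2 = ‖ι (C z)‖ ^ 2 -
      2 * ∫ s in t₀..t, ⟪F s, C (adjoint ι (ι (C (z - ∫ r in t₀..s, F r))))⟫_ℝ := by
  have hsub {s : ℝ} (hs : s ∈ uIcc t₀ t) : ι (C (z - ∫ r in t₀..s, F r)) =
      ι (C z) + ∫ r in t₀..s, -(ι ∘L C) (F r) := by
    have h1 : IntervalIntegrable F volume t₀ s := hF.mono_set (uIcc_subset_uIcc (by simp) hs)
    rw [intervalIntegral.integral_neg, ContinuousLinearMap.intervalIntegral_comp_comm _ h1,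
      map_sub, map_sub, sub_eq_add_neg]
    rfl
  have h2 : IntervalIntegrable (fun r => -(ι ∘L C) (F r)) volume t₀ t :=
    IntervalIntegrable.neg (f := fun r => (ι ∘L C) (F r))
      ⟨(ι ∘L C).integrable_comp hF.1, (ι ∘L C).integrable_comp hF.2⟩
  have h3 := inner_primitive_eq h2 h2 (ι (C z)) (ι (C z))
  rw [← hsub (by simp), real_inner_self_eq_norm_sq, real_inner_self_eq_norm_sq] at h3
  rw [h3, sub_eq_add_neg, ← intervalIntegral.integral_const_mul, ← intervalIntegral.integral_neg]
  congr 1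
  refine intervalIntegral.integral_congr fun s hs => ?_
  rw [← hsub hs, real_inner_comm, ← two_mul, inner_neg_right, ← hC, adjoint_inner_right]
  rw [real_inner_comm]
  simp

theorem norm_smoothing_smoothing_sub_le (n : ℕ) (x : V) :
    ‖smoothing ι n (adjoint ι (ι (smoothing ι n (adjoint ι (ι x))))) - x‖ ≤
      2 * ‖smoothing ι n (adjoint ι (ι x)) - x‖ := by
  set y := smoothing ι n (adjoint ι (ι x)) with hy
  have h1 : smoothing ι n (adjoint ι (ι y)) - x =
      smoothing ι n (adjoint ι (ι (y - x))) + (y - x) := by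
    simp only [map_sub, ← hy]; abel
  rw [h1, two_mul]
  refine (norm_add_le _ _).trans ?_
  gcongr
  exact (isResolvent_smoothing ι n).norm_map_le Nat.one_div_pos_of_nat _

theorem tendsto_smoothing_smoothing (hι : Function.Injective ι) (x : V) :
    Tendsto (fun n => smoothing ι n (adjoint ι (ι (smoothing ι n (adjoint ι (ι x)))))) atTop
      (𝓝 x) := by
  rw [tendsto_iff_norm_sub_tendsto_zero]
  have h := (tendsto_iff_norm_sub_tendsto_zero.mp (tendsto_smoothing hι x)).const_mul 2
  rw [mul_zero] at h
  exact squeeze_zero (fun _ => norm_nonneg _) (fun n => norm_smoothing_smoothing_sub_le n x) h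

theorem integrable_norm_mul_norm {E F : Type*} [NormedAddCommGroup E] [NormedAddCommGroup F]
    {α : Type*} [MeasurableSpace α] {μ : Measure α} {f : α → E} {g : α → F}
    (hf : MemLp f 2 μ) (hg : MemLp g 2 μ) : Integrable (fun s => ‖f s‖ * ‖g s‖) μ :=
  hf.norm.integrable_mul hg.norm

theorem ae_uIoc_of_ae_restrict {p : ℝ → Prop} (hp : ∀ᵐ s ∂(volume.restrict (Icc t₀ t₁)), p s)
    {t : ℝ} (ht : t ∈ Icc t₀ t₁) : ∀ᵐ s, s ∈ uIoc t₀ t → p s := by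
  filter_upwards [(ae_restrict_iff' measurableSet_Icc).mp hp] with s hs hst
  rw [uIoc_of_le ht.1] at hst
  exact hs ⟨hst.1.le, hst.2.trans ht.2⟩

/-- The energy identity. -/
theorem IsEvolution.norm_sq_eq (hι : Function.Injective ι) (hd : DenseRange ι)
    (ha : ContinuousOn a (Icc t₀ t₁)) {u₀ : H} {u : ℝ → H} {U : ℝ → V}
    (h : IsEvolution ι a t₀ t₁ u₀ u U) {t : ℝ} (ht : t ∈ Icc t₀ t₁) :
    ‖u t‖ ^ 2 = ‖u₀‖ ^ 2 - 2 * ∫ s in t₀..t, ⟪a s (U s), U s⟫_ℝ := by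
  have hF := memLp_clm_apply ha h.memLp
  have hFi := intervalIntegrable_of_memLp hF ht
  let T (n : ℕ) (x : V) : V := smoothing ι n (adjoint ι (ι (smoothing ι n (adjoint ι (ι x)))))
  have hTc (n : ℕ) : Continuous (T n) := by fun_prop
  -- The energy identity of the smoothed curve. Under the integral `ι† u(s) = ι† ι U(s)` almost
  -- everywhere, which produces `T n (U s)`.
  have key (n : ℕ) : ‖ι (smoothing ι n (adjoint ι (u t)))‖ ^ 2 =
      ‖ι (smoothing ι n (adjoint ι u₀))‖ ^ 2 -
        2 * ∫ s in t₀..t, ⟪a s (U s), T n (U s)⟫_ℝ := by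
    rw [h.eq_integral t ht,
      norm_sq_comp_primitive (isResolvent_smoothing ι n).inner_map_left hFi (adjoint ι u₀)]
    congr 2
    refine intervalIntegral.integral_congr_ae ?_
    filter_upwards [ae_uIoc_of_ae_restrict h.ae_eq ht] with s hs hst
    rw [uIoc_of_le ht.1] at hst
    rw [← h.eq_integral s ⟨hst.1.le, hst.2.trans ht.2⟩, hs (by rwa [uIoc_of_le ht.1])]
  have hlim : Tendsto (fun n => ∫ s in t₀..t, ⟪a s (U s), T n (U s)⟫_ℝ) atTop
      (𝓝 (∫ s in t₀..t, ⟪a s (U s), U s⟫_ℝ)) := by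
    have hmono : volume.restrict (uIoc t₀ t) ≤ volume.restrict (Icc t₀ t₁) := by
      rw [uIoc_of_le ht.1]
      exact Measure.restrict_mono (Ioc_subset_Icc_self.trans (Icc_subset_Icc_right ht.2)) le_rfl
    -- The dominating function is independent of `n` because each `T n` is a contraction.
    refine intervalIntegral.tendsto_integral_filter_of_dominated_convergence
      (fun s => ‖a s (U s)‖ * ‖U s‖) ?_ ?_ ?_ ?_
    · exact Eventually.of_forall fun n => (hF.aestronglyMeasurable.inner
        ((hTc n).comp_aestronglyMeasurable h.memLp.aestronglyMeasurable)).mono_measure hmono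
    · refine Eventually.of_forall fun n => Eventually.of_forall fun s _ => ?_
      refine (norm_inner_le_norm _ _).trans ?_
      gcongr
      have hG := isResolvent_smoothing ι n
      exact (hG.norm_map_le Nat.one_div_pos_of_nat _).trans
        (hG.norm_map_le Nat.one_div_pos_of_nat _)
    · exact intervalIntegrable_of_integrable_restrict (integrable_norm_mul_norm hF h.memLp) ht
    · exact Eventually.of_forall fun s _ =>
        tendsto_const_nhds.inner (tendsto_smoothing_smoothing hι (U s))
  have h1 := ((tendsto_comp_smoothing hι hd (u t)).norm.pow 2)
  have h2 := ((tendsto_comp_smoothing hι hd u₀).norm.pow 2).sub (hlim.const_mul 2)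
  exact tendsto_nhds_unique (h1.congr key) h2

/-- A linear functional bounded by the norm of `K φ` is represented by an inner product with
`K φ`. -/
theorem exists_forall_inner_eq {Φ W : Type*} [AddCommGroup Φ] [Module ℝ Φ] [NormedAddCommGroup W]
    [InnerProductSpace ℝ W] [CompleteSpace W] (K : Φ →ₗ[ℝ] W) (ℓ : Φ →ₗ[ℝ] ℝ) (C : ℝ)
    (h : ∀ φ, |ℓ φ| ≤ C * ‖K φ‖) : ∃ U : W, ∀ φ, ⟪U, K φ⟫_ℝ = ℓ φ := by
  -- By the bound, `ℓ` factors through the range of `K` as a bounded functional; Hahn–Banach and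
  -- Riesz then provide `U`.
  have hker : LinearMap.ker K ≤ LinearMap.ker ℓ := fun φ hφ => by
    rw [LinearMap.mem_ker] at hφ ⊢
    have := h φ
    rw [hφ, norm_zero, mul_zero] at this
    exact abs_eq_zero.mp (le_antisymm this (abs_nonneg _))
  let m : LinearMap.range K →ₗ[ℝ] ℝ :=
    ((LinearMap.ker K).liftQ ℓ hker) ∘ₗ K.quotKerEquivRange.symm.toLinearMap
  have hm (φ : Φ) : m ⟨K φ, LinearMap.mem_range_self K φ⟩ = ℓ φ := by
    have h1 : K.quotKerEquivRange.symm ⟨K φ, LinearMap.mem_range_self K φ⟩ =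
        (LinearMap.ker K).mkQ φ := by
      rw [LinearEquiv.symm_apply_eq]; rfl
    simp only [m, LinearMap.comp_apply, LinearEquiv.coe_coe, h1]
    rfl
  have hbound : ∀ x : LinearMap.range K, ‖m x‖ ≤ C * ‖x‖ := by
    rintro ⟨x, φ, rfl⟩
    rw [hm]
    exact h φ
  obtain ⟨g, hg, -⟩ := exists_extension_norm_eq (LinearMap.range K) (m.mkContinuous C hbound)
  refine ⟨(InnerProductSpace.toDual ℝ W).symm g, fun φ => ?_⟩
  rw [InnerProductSpace.toDual_symm_apply, ← hm φ]
  exact hg ⟨K φ, LinearMap.mem_range_self K φ⟩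

end Evolution
end FokkerPlanck

namespace FokkerPlanck
open ContinuousLinearMap Filter
open scoped InnerProductSpace Topology

/-! ### Existence of solutions by duality with the backward problem. -/

section Existence

variable {H V : Type*} [NormedAddCommGroup H] [InnerProductSpace ℝ H] [CompleteSpace H]
  [NormedAddCommGroup V] [InnerProductSpace ℝ V] [CompleteSpace V]
  {ι : V →L[ℝ] H} {a : ℝ → V →L[ℝ] V} {t₀ t₁ κ : ℝ}

/-- Continuously differentiable curves in `V` which vanish at the final time. -/
def testCurves (V : Type*) [NormedAddCommGroup V] [NormedSpace ℝ V] (t₁ : ℝ) :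
    Submodule ℝ (ℝ → V) where
  carrier := {φ | ContDiff ℝ 1 φ ∧ φ t₁ = 0}
  add_mem' h h' := ⟨h.1.add h'.1, by simp [h.2, h'.2]⟩
  zero_mem' := ⟨contDiff_const, rfl⟩
  smul_mem' c _ h := ⟨contDiff_const.smul h.1, by simp [h.2]⟩

/-- The backward adjoint operator `φ ↦ a† φ - ι† ι (∂ₜ φ)`. -/
noncomputable def backward (ι : V →L[ℝ] H) (a : ℝ → V →L[ℝ] V) (φ : ℝ → V) (s : ℝ) : V :=
  adjoint (a s) (φ s) - adjoint ι (ι (deriv φ s))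

theorem continuousOn_backward (ha : ContinuousOn a (Icc t₀ t₁)) {φ : ℝ → V}
    (hφ : ContDiff ℝ 1 φ) : ContinuousOn (backward ι a φ) (Icc t₀ t₁) := by
  have h1 : ContinuousOn (fun s => adjoint (a s)) (Icc t₀ t₁) :=
    (adjoint (𝕜 := ℝ) (E := V) (F := V)).continuous.comp_continuousOn ha
  have h2 : Continuous (deriv φ) := hφ.continuous_deriv_one
  exact (h1.clm_apply hφ.continuous.continuousOn).sub (by fun_prop)

theorem memLp_of_continuousOn {E : Type*} [NormedAddCommGroup E] [SecondCountableTopologyEither ℝ E]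
    {f : ℝ → E} (hf : ContinuousOn f (Icc t₀ t₁)) :
    MemLp f 2 (volume.restrict (Icc t₀ t₁)) := by
  obtain ⟨C, hC⟩ := isCompact_Icc.exists_bound_of_continuousOn hf
  refine MemLp.of_bound (hf.aestronglyMeasurable measurableSet_Icc) C ?_
  filter_upwards [ae_restrict_mem measurableSet_Icc] with s hs using hC s hs

/-- The backward adjoint operator as a linear map into `L²(t₀, t₁; V)`. -/
noncomputable def backwardLp (ι : V →L[ℝ] H) (ha : ContinuousOn a (Icc t₀ t₁)) :
    testCurves V t₁ →ₗ[ℝ] Lp V 2 (volume.restrict (Icc t₀ t₁)) where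
  toFun φ := (memLp_of_continuousOn (continuousOn_backward (ι := ι) ha φ.2.1)).toLp
  map_add' φ ψ := by
    rw [← MemLp.toLp_add]
    congr 1
    ext s
    have h1 := (φ.2.1.differentiable one_ne_zero s)
    have h2 := (ψ.2.1.differentiable one_ne_zero s)
    simp only [backward, Submodule.coe_add, Pi.add_apply, deriv_add h1 h2, map_add]
    abel
  map_smul' c φ := by
    rw [RingHom.id_apply, ← MemLp.toLp_const_smul]
    congr 1
    ext s
    have h1 := (φ.2.1.differentiable one_ne_zero s)
    simp only [backward, Submodule.coe_smul, Pi.smul_apply, deriv_const_smul c h1, map_smul,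
      smul_sub]

theorem inner_backwardLp (ha : ContinuousOn a (Icc t₀ t₁))
    (U : Lp V 2 (volume.restrict (Icc t₀ t₁))) (φ : testCurves V t₁) :
    ⟪U, backwardLp ι ha φ⟫_ℝ = ∫ s in Icc t₀ t₁, ⟪U s, backward ι a φ s⟫_ℝ := by
  rw [L2.inner_def]
  refine integral_congr_ae ?_
  filter_upwards [(memLp_of_continuousOn (continuousOn_backward (ι := ι) ha φ.2.1)).coeFn_toLp]
    with s hs
  change ⟪U s, (memLp_of_continuousOn (continuousOn_backward (ι := ι) ha φ.2.1)).toLp _ s⟫_ℝ = _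
  rw [hs]

theorem norm_sq_backwardLp (ha : ContinuousOn a (Icc t₀ t₁)) (φ : testCurves V t₁) :
    ‖backwardLp ι ha φ‖ ^ 2 = ∫ s in Icc t₀ t₁, ‖backward ι a φ s‖ ^ 2 := by
  rw [← real_inner_self_eq_norm_sq, inner_backwardLp]
  refine integral_congr_ae ?_
  filter_upwards [(memLp_of_continuousOn (continuousOn_backward (ι := ι) ha φ.2.1)).coeFn_toLp]
    with s hs
  rw [← real_inner_self_eq_norm_sq]
  change ⟪(memLp_of_continuousOn (continuousOn_backward (ι := ι) ha φ.2.1)).toLp _ s, _⟫_ℝ = _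
  rw [hs]

/-- A priori estimate for the backward problem with zero final value. The form controls only `‖φ‖² -
‖ι φ‖²`; the missing `‖ι φ‖²` is supplied by differentiating the weight `exp (2κ (s - t₀))`. -/
theorem norm_sq_le_integral_backward (ht : t₀ ≤ t₁) (hκ : 0 < κ)
    (ha : ContinuousOn a (Icc t₀ t₁))
    (hco : ∀ t ∈ Icc t₀ t₁, ∀ v, ⟪a t v, v⟫_ℝ = κ * (‖v‖ ^ 2 - ‖ι v‖ ^ 2)) {φ : ℝ → V}
    (hφ : ContDiff ℝ 1 φ) (hφ₁ : φ t₁ = 0) :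
    ‖ι (φ t₀)‖ ^ 2 ≤ Real.exp (2 * κ * (t₁ - t₀)) / (2 * κ) *
      ∫ s in Icc t₀ t₁, ‖backward ι a φ s‖ ^ 2 := by
  let w (s : ℝ) := Real.exp (2 * κ * (s - t₀))
  have hw (s : ℝ) : HasDerivAt w (2 * κ * w s) s := by
    have h := (((hasDerivAt_id s).sub_const t₀).const_mul (2 * κ)).exp
    simpa [w, mul_comm] using h
  have hφd (s : ℝ) : HasDerivAt φ (deriv φ s) s := (hφ.differentiable one_ne_zero s).hasDerivAt
  have hιφ (s : ℝ) : HasDerivAt (fun s => ι (φ s)) (ι (deriv φ s)) s :=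
    ι.hasFDerivAt.comp_hasDerivAt s (hφd s)
  have hder (s : ℝ) : HasDerivAt (fun s => w s * ‖ι (φ s)‖ ^ 2)
      (2 * κ * w s * ‖ι (φ s)‖ ^ 2 + w s * (2 * ⟪ι (φ s), ι (deriv φ s)⟫_ℝ)) s :=
    (hw s).mul (hιφ s).norm_sq
  have hwc : Continuous w := by fun_prop
  have hφc := hφ.continuous
  have hφ'c := hφ.continuous_deriv_one
  have hdc : Continuous fun s =>
      2 * κ * w s * ‖ι (φ s)‖ ^ 2 + w s * (2 * ⟪ι (φ s), ι (deriv φ s)⟫_ℝ) := by fun_prop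
  have hftc := intervalIntegral.integral_eq_sub_of_hasDerivAt (fun s _ => hder s)
    (hdc.intervalIntegrable t₀ t₁)
  have hw0 : w t₀ = 1 := by simp [w]
  rw [hφ₁, map_zero, norm_zero, hw0, one_mul, intervalIntegral.integral_of_le ht,
    ← integral_Icc_eq_integral_Ioc] at hftc
  have hbc := continuousOn_backward (ι := ι) ha hφ
  have hle : ∫ s in Icc t₀ t₁, -(Real.exp (2 * κ * (t₁ - t₀)) / (2 * κ) *
      ‖backward ι a φ s‖ ^ 2) ≤ ∫ s in Icc t₀ t₁,
      (2 * κ * w s * ‖ι (φ s)‖ ^ 2 + w s * (2 * ⟪ι (φ s), ι (deriv φ s)⟫_ℝ)) := by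
    refine setIntegral_mono_on ?_ (hdc.continuousOn.integrableOn_Icc) measurableSet_Icc ?_
    · exact ContinuousOn.integrableOn_Icc (((hbc.norm.pow 2).const_smul
        (Real.exp (2 * κ * (t₁ - t₀)) / (2 * κ))).neg)
    · intro s hs
      have h1 : ⟪φ s, backward ι a φ s⟫_ℝ =
          κ * (‖φ s‖ ^ 2 - ‖ι (φ s)‖ ^ 2) - ⟪ι (φ s), ι (deriv φ s)⟫_ℝ := by
        rw [backward, inner_sub_right, adjoint_inner_right, adjoint_inner_right, hco s hs]
      have h2 := real_inner_le_norm (φ s) (backward ι a φ s)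
      have hw1 : 0 < w s := Real.exp_pos _
      have hw2 : w s ≤ Real.exp (2 * κ * (t₁ - t₀)) := by
        apply Real.exp_le_exp.mpr
        have := hs.2
        gcongr
      -- By `h1` the right side equals `2κ ‖φ‖² - 2 ⟪φ, backward φ⟫`; complete the square.
      have h3 : -(‖backward ι a φ s‖ ^ 2 / (2 * κ)) ≤
          2 * κ * ‖ι (φ s)‖ ^ 2 + 2 * ⟪ι (φ s), ι (deriv φ s)⟫_ℝ := by
        rw [neg_le_iff_add_nonneg', ← mul_le_mul_iff_right₀ (by positivity : 0 < 2 * κ), mul_zero,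
          mul_add, mul_div_cancel₀ _ (by positivity : 2 * κ ≠ 0)]
        nlinarith [sq_nonneg (‖backward ι a φ s‖ - 2 * κ * ‖φ s‖)]
      calc _ = Real.exp (2 * κ * (t₁ - t₀)) * -(‖backward ι a φ s‖ ^ 2 / (2 * κ)) := by ring
        _ ≤ w s * -(‖backward ι a φ s‖ ^ 2 / (2 * κ)) := by
          have : 0 ≤ ‖backward ι a φ s‖ ^ 2 / (2 * κ) := by positivity
          nlinarith
        _ ≤ w s * (2 * κ * ‖ι (φ s)‖ ^ 2 + 2 * ⟪ι (φ s), ι (deriv φ s)⟫_ℝ) := by gcongr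
        _ = _ := by ring
  rw [integral_neg, integral_const_mul, hftc] at hle
  simp only [ne_eq, OfNat.ofNat_ne_zero, not_false_eq_true, zero_pow, mul_zero, zero_sub] at hle
  linarith

/-- Existence of a solution in the very weak sense. -/
theorem exists_forall_integral_backward_eq (ht : t₀ ≤ t₁) (hκ : 0 < κ)
    (ha : ContinuousOn a (Icc t₀ t₁))
    (hco : ∀ t ∈ Icc t₀ t₁, ∀ v, ⟪a t v, v⟫_ℝ = κ * (‖v‖ ^ 2 - ‖ι v‖ ^ 2)) (u₀ : H) :
    ∃ U : ℝ → V, MemLp U 2 (volume.restrict (Icc t₀ t₁)) ∧ ∀ φ : ℝ → V, ContDiff ℝ 1 φ →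
      φ t₁ = 0 → ∫ s in Icc t₀ t₁, ⟪U s, backward ι a φ s⟫_ℝ = ⟪u₀, ι (φ t₀)⟫_ℝ := by
  let ℓ : testCurves V t₁ →ₗ[ℝ] ℝ :=
    (innerSL ℝ u₀ ∘L ι).toLinearMap ∘ₗ (LinearMap.proj t₀ ∘ₗ (testCurves V t₁).subtype)
  have hℓ (φ : testCurves V t₁) : ℓ φ = ⟪u₀, ι (φ.1 t₀)⟫_ℝ := rfl
  set M := Real.exp (2 * κ * (t₁ - t₀)) / (2 * κ) with hM
  have hM0 : 0 ≤ M := by positivity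
  -- The a priori estimate is exactly the bound needed to represent the initial datum through the
  -- backward operator.
  obtain ⟨U, hU⟩ := exists_forall_inner_eq (backwardLp ι ha) ℓ (‖u₀‖ * √M) fun φ => by
    rw [hℓ, mul_assoc]
    refine (abs_real_inner_le_norm _ _).trans ?_
    gcongr
    rw [← Real.sqrt_sq (norm_nonneg (backwardLp ι ha φ)), ← Real.sqrt_mul hM0]
    refine Real.le_sqrt_of_sq_le ?_
    rw [norm_sq_backwardLp]
    exact norm_sq_le_integral_backward ht hκ ha hco φ.2.1 φ.2.2
  refine ⟨U, Lp.memLp U, fun φ hφ hφ₁ => ?_⟩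
  rw [← hℓ ⟨φ, hφ, hφ₁⟩, ← hU, inner_backwardLp]

theorem integrable_inner_of_memLp {E α : Type*} [NormedAddCommGroup E] [InnerProductSpace ℝ E]
    [MeasurableSpace α] {μ : Measure α} {f g : α → E} (hf : MemLp f 2 μ) (hg : MemLp g 2 μ) :
    Integrable (fun s => ⟪f s, g s⟫_ℝ) μ :=
  (integrable_norm_mul_norm hf hg).mono'
    (hf.aestronglyMeasurable.inner hg.aestronglyMeasurable)
    (Eventually.of_forall fun _ => norm_inner_le_norm _ _)

/-- A very weak solution satisfies the time-integrated equation almost everywhere. -/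
theorem ae_adjoint_comp_eq (ht : t₀ ≤ t₁) (ha : ContinuousOn a (Icc t₀ t₁)) {u₀ : H} {U : ℝ → V}
    (hU : MemLp U 2 (volume.restrict (Icc t₀ t₁)))
    (h : ∀ φ : ℝ → V, ContDiff ℝ 1 φ → φ t₁ = 0 →
      ∫ s in Icc t₀ t₁, ⟪U s, backward ι a φ s⟫_ℝ = ⟪u₀, ι (φ t₀)⟫_ℝ) :
    ∀ᵐ s ∂(volume.restrict (Icc t₀ t₁)),
      adjoint ι (ι (U s)) = adjoint ι u₀ - ∫ r in t₀..s, a r (U r) := by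
  have hF := memLp_clm_apply ha hU
  have hFi := intervalIntegrable_of_memLp hF (right_mem_Icc.mpr ht)
  let z (s : ℝ) : V := adjoint ι u₀ - ∫ r in t₀..s, a r (U r)
  have hzc : ContinuousOn z (Icc t₀ t₁) := by
    have := intervalIntegral.continuousOn_primitive_interval' hFi (left_mem_uIcc)
    rw [uIcc_of_le ht] at this
    exact continuousOn_const.sub this
  have hz2 := memLp_of_continuousOn hzc
  have hSU : MemLp (fun s => adjoint ι (ι (U s))) 2 (volume.restrict (Icc t₀ t₁)) :=
    (adjoint ι ∘L ι).comp_memLp' hU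
  have hdiff := hSU.sub hz2
  have hint := hdiff.integrable one_le_two
  suffices hs : ∀ᵐ s ∂(volume.restrict (Icc t₀ t₁)), adjoint ι (ι (U s)) - z s = 0 by
    filter_upwards [hs] with s hs using sub_eq_zero.mp hs
  -- Fundamental lemma of the calculus of variations with scalar test functions `θ`, each vector
  -- integral being tested against an arbitrary `v`.
  refine ae_eq_zero_of_integral_contDiff_smul_eq_zero hint.locallyIntegrable
    fun θ hθ hθc => ?_
  have hθi : Integrable (fun s => θ s • (adjoint ι (ι (U s)) - z s))
      (volume.restrict (Icc t₀ t₁)) := by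
    obtain ⟨C, hC⟩ := hθ.continuous.bounded_above_of_compact_support hθc
    exact hint.bdd_smul C hθ.continuous.aestronglyMeasurable (Eventually.of_forall hC)
  refine ext_inner_right ℝ fun v => ?_
  rw [inner_zero_left, real_inner_comm, ← integral_inner hθi]
  -- the test curve with derivative `θ • v`
  let φ (s : ℝ) : V := (∫ r in t₁..s, θ r) • v
  have hφd (s : ℝ) : HasDerivAt φ (θ s • v) s :=
    (hθ.continuous.integral_hasStrictDerivAt t₁ s).hasDerivAt.smul_const v
  have hφ' : deriv φ = fun s => θ s • v := funext fun s => (hφd s).deriv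
  have hθc' := hθ.continuous
  have hφ : ContDiff ℝ 1 φ := by
    rw [contDiff_one_iff_deriv]
    exact ⟨fun s => (hφd s).differentiableAt, by rw [hφ']; fun_prop⟩
  have hφ₁ : φ t₁ = 0 := by simp [φ]
  have h1 := h φ hφ hφ₁
  have hφ'i : IntervalIntegrable (fun s => θ s • v) volume t₀ t₁ :=
    Continuous.intervalIntegrable (by fun_prop) _ _
  have hφI (s : ℝ) : φ t₀ + ∫ r in t₀..s, θ r • v = φ s := by
    rw [intervalIntegral.integral_eq_sub_of_hasDerivAt (fun r _ => hφd r)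
      (Continuous.intervalIntegrable (by fun_prop) _ _)]
    abel
  -- Integration by parts of `⟪z, φ⟫`: the term at `t₁` vanishes and the one at `t₀` cancels against
  -- the initial datum in `h1`.
  have h2 := inner_primitive_eq hFi.neg hφ'i (adjoint ι u₀) (φ t₀)
  simp only [Pi.neg_apply, intervalIntegral.integral_neg, ← sub_eq_add_neg, hφI] at h2
  rw [hφ₁, inner_zero_right, adjoint_inner_left, intervalIntegral.integral_of_le ht,
    ← integral_Icc_eq_integral_Ioc, ← h1, ← integral_add] at h2
  · rw [← neg_zero, h2, ← integral_neg]
    refine integral_congr_ae (Eventually.of_forall fun s => ?_)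
    simp only [backward, hφ', inner_sub_right, inner_sub_left, adjoint_inner_right, inner_smul_right,
      map_smul, inner_neg_left, z, adjoint_inner_left]
    rw [real_inner_comm u₀, real_inner_comm (ι (U s)), real_inner_comm v]
    ring
  · exact integrable_inner_of_memLp hU (memLp_of_continuousOn (continuousOn_backward ha hφ))
  · exact (integrable_inner_of_memLp hF.neg (memLp_of_continuousOn hφ.continuous.continuousOn)).add
      (integrable_inner_of_memLp hz2 (memLp_of_continuousOn (by fun_prop)))

/-- Existence of solutions. -/
theorem exists_isEvolution (hι : Function.Injective ι) (hd : DenseRange ι) (ht : t₀ ≤ t₁)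
    (hκ : 0 < κ) (ha : ContinuousOn a (Icc t₀ t₁))
    (hco : ∀ t ∈ Icc t₀ t₁, ∀ v, ⟪a t v, v⟫_ℝ = κ * (‖v‖ ^ 2 - ‖ι v‖ ^ 2)) (u₀ : H) :
    ∃ u U, u t₀ = u₀ ∧ IsEvolution ι a t₀ t₁ u₀ u U := by
  obtain ⟨U, hU, hUφ⟩ := exists_forall_integral_backward_eq ht hκ ha hco u₀
  have hae := ae_adjoint_comp_eq ht ha hU hUφ
  have hF := memLp_clm_apply ha hU
  have hFi := intervalIntegrable_of_memLp hF (right_mem_Icc.mpr ht)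
  let z (s : ℝ) : V := adjoint ι u₀ - ∫ r in t₀..s, a r (U r)
  have hzc : ContinuousOn z (Icc t₀ t₁) := by
    have := intervalIntegral.continuousOn_primitive_interval' hFi (left_mem_uIcc)
    rw [uIcc_of_le ht] at this
    exact continuousOn_const.sub this
  -- So far `ι U` is defined only almost everywhere; its continuous representative will be the
  -- uniform limit of the `y n`.
  let y (n : ℕ) (t : ℝ) : H := ι (smoothing ι n (z t))
  let e (n : ℕ) : ℝ := ‖ι (smoothing ι n (adjoint ι u₀)) - u₀‖
  let r (n : ℕ) (s : ℝ) : ℝ := ‖a s (U s)‖ * ‖smoothing ι n (adjoint ι (ι (U s))) - U s‖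
  have hrm (n : ℕ) : AEStronglyMeasurable (r n) (volume.restrict (Icc t₀ t₁)) := by
    have h1 : Continuous fun v : V => ‖smoothing ι n (adjoint ι (ι v)) - v‖ := by fun_prop
    exact hF.aestronglyMeasurable.norm.mul (h1.comp_aestronglyMeasurable hU.aestronglyMeasurable)
  have hrb (n : ℕ) (s : ℝ) : ‖r n s‖ ≤ ‖a s (U s)‖ * ‖U s‖ := by
    rw [Real.norm_of_nonneg (by positivity)]
    refine mul_le_mul_of_nonneg_left ?_ (norm_nonneg _)
    exact norm_smoothing_comp_sub_le ι n (U s)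
  have hri (n : ℕ) : Integrable (r n) (volume.restrict (Icc t₀ t₁)) :=
    (integrable_norm_mul_norm hF hU).mono' (hrm n) (Eventually.of_forall (hrb n))
  let D (n : ℕ) : ℝ := ∫ s in Icc t₀ t₁, r n s
  have hD : Tendsto D atTop (𝓝 0) := by
    have := tendsto_integral_of_dominated_convergence (μ := volume.restrict (Icc t₀ t₁))
      (fun s => ‖a s (U s)‖ * ‖U s‖) hrm
      (integrable_norm_mul_norm hF hU) (fun n => Eventually.of_forall (hrb n))
      (f := fun _ => 0) (Eventually.of_forall fun s => by
        have := (tendsto_iff_norm_sub_tendsto_zero.mp (tendsto_smoothing hι (U s))).const_mul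
          ‖a s (U s)‖
        rwa [mul_zero] at this)
    simpa [D] using this
  have he : Tendsto e atTop (𝓝 0) :=
    tendsto_iff_norm_sub_tendsto_zero.mp (tendsto_comp_smoothing hι hd u₀)
  have hbound (n m : ℕ) {t : ℝ} (htt : t ∈ Icc t₀ t₁) :
      ‖y n t - y m t‖ ^ 2 ≤ (e n + e m) ^ 2 + 4 * (D n + D m) := by
    -- The energy identity for the difference of two smoothings bounds it by the initial error and
    -- an integral error, uniformly in time.
    let C : V →L[ℝ] V := smoothing ι n - smoothing ι m
    have hC (x : V) : C x = smoothing ι n x - smoothing ι m x := rfl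
    have hCs : ∀ x x', ⟪C x, x'⟫_ℝ = ⟪x, C x'⟫_ℝ := fun x x' => by
      rw [hC, hC, inner_sub_left, inner_sub_right, (isResolvent_smoothing ι n).inner_map_left,
        (isResolvent_smoothing ι m).inner_map_left]
    have h1 := norm_sq_comp_primitive (ι := ι) hCs (intervalIntegrable_of_memLp hF htt)
      (adjoint ι u₀)
    have h2 : y n t - y m t = ι (C (z t)) := by rw [hC, map_sub]
    have h3 : ‖ι (C (adjoint ι u₀))‖ ≤ e n + e m := by
      rw [hC, map_sub]
      have := norm_sub_le (ι (smoothing ι n (adjoint ι u₀)) - u₀)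
        (ι (smoothing ι m (adjoint ι u₀)) - u₀)
      rwa [sub_sub_sub_cancel_right] at this
    have h4 : |∫ s in t₀..t, ⟪a s (U s), C (adjoint ι (ι (C (z s))))⟫_ℝ| ≤ 2 * (D n + D m) := by
      have hsub : Ioc t₀ t ⊆ Icc t₀ t₁ := Ioc_subset_Icc_self.trans (Icc_subset_Icc_right htt.2)
      have h5 : ∀ᵐ s ∂(volume.restrict (Icc t₀ t₁)),
          ‖⟪a s (U s), C (adjoint ι (ι (C (z s))))⟫_ℝ‖ ≤ 2 * (r n s + r m s) := by
        filter_upwards [hae] with s hs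
        have h6 (x : V) : ‖C (adjoint ι (ι x))‖ ≤ 2 * ‖x‖ := by
          rw [hC, two_mul]
          exact (norm_sub_le _ _).trans (add_le_add
            ((isResolvent_smoothing ι n).norm_map_le Nat.one_div_pos_of_nat x)
            ((isResolvent_smoothing ι m).norm_map_le Nat.one_div_pos_of_nat x))
        have h7 : ‖C (z s)‖ ≤ ‖smoothing ι n (adjoint ι (ι (U s))) - U s‖ +
            ‖smoothing ι m (adjoint ι (ι (U s))) - U s‖ := by
          have := norm_sub_le (smoothing ι n (adjoint ι (ι (U s))) - U s)
            (smoothing ι m (adjoint ι (ι (U s))) - U s)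
          rw [sub_sub_sub_cancel_right] at this
          rwa [show z s = _ from hs.symm, hC]
        calc _ ≤ ‖a s (U s)‖ * ‖C (adjoint ι (ι (C (z s))))‖ := norm_inner_le_norm _ _
          _ ≤ ‖a s (U s)‖ * (2 * (‖smoothing ι n (adjoint ι (ι (U s))) - U s‖ +
            ‖smoothing ι m (adjoint ι (ι (U s))) - U s‖)) := by
              gcongr; exact (h6 _).trans (by gcongr)
          _ = 2 * (r n s + r m s) := by simp only [r]; ring
      have hrr := ((hri n).add (hri m)).const_mul 2
      rw [intervalIntegral.integral_of_le htt.1, ← Real.norm_eq_abs]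
      calc _ ≤ ∫ s in Ioc t₀ t, 2 * (r n s + r m s) :=
            norm_integral_le_of_norm_le (IntegrableOn.mono_set hrr hsub)
              (ae_restrict_of_ae_restrict_of_subset hsub h5)
        _ ≤ ∫ s in Icc t₀ t₁, 2 * (r n s + r m s) := by
            refine setIntegral_mono_set hrr (Eventually.of_forall fun s => ?_)
              (LE.le.eventuallyLE hsub)
            simp only [r, Pi.zero_apply]; positivity
        _ = 2 * (D n + D m) := by rw [integral_const_mul, integral_add (hri n) (hri m)]
    rw [h2]
    change ‖ι (C (adjoint ι u₀ - ∫ s in t₀..t, a s (U s)))‖ ^ 2 ≤ _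
    rw [h1]
    have := abs_le.mp h4
    have h8 : ‖ι (C (adjoint ι u₀))‖ ^ 2 ≤ (e n + e m) ^ 2 := by gcongr
    linarith
  have hcauchy : UniformCauchySeqOn y atTop (Icc t₀ t₁) := by
    rw [Metric.uniformCauchySeqOn_iff]
    intro ε hε
    -- With these thresholds the bound is at most `ε²/4 + 4 · ε²/16 = ε²/2 < ε²`.
    obtain ⟨N, hN⟩ := eventually_atTop.mp
      ((he.eventually_lt_const (by positivity : 0 < ε / 4)).and
        (hD.eventually_lt_const (by positivity : 0 < ε ^ 2 / 32)))
    refine ⟨N, fun m hm n hn t htt => ?_⟩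
    obtain ⟨h1, h2⟩ := hN m hm
    obtain ⟨h3, h4⟩ := hN n hn
    have h5 := hbound m n htt
    have h6 : (e m + e n) ^ 2 ≤ (ε / 2) ^ 2 := by
      have : 0 ≤ e m := norm_nonneg _
      have : 0 ≤ e n := norm_nonneg _
      gcongr
      linarith
    rw [dist_eq_norm]
    exact lt_of_pow_lt_pow_left₀ 2 hε.le (by nlinarith)
  let u (t : ℝ) : H := limUnder atTop fun n => y n t
  have hu {t : ℝ} (htt : t ∈ Icc t₀ t₁) : Tendsto (fun n => y n t) atTop (𝓝 (u t)) :=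
    (hcauchy.cauchySeq htt).tendsto_limUnder
  have hunif : TendstoUniformlyOn y u atTop (Icc t₀ t₁) :=
    hcauchy.tendstoUniformlyOn_of_tendsto fun t htt => hu htt
  refine ⟨u, U, ?_, ?_, hU, ?_, fun t htt => ?_⟩
  · refine tendsto_nhds_unique (hu (left_mem_Icc.mpr ht)) ?_
    simpa [y, z] using tendsto_comp_smoothing hι hd u₀
  · refine hunif.continuousOn (Frequently.of_forall fun n => ?_)
    exact (ι ∘L smoothing ι n).continuous.comp_continuousOn hzc
  · filter_upwards [hae, ae_restrict_mem measurableSet_Icc] with s hs hst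
    refine tendsto_nhds_unique (hu hst) ?_
    have := (ι.continuous.tendsto _).comp (tendsto_smoothing hι (U s))
    rw [hs] at this
    exact this
  · change _ = z t
    -- The resolvent equation reads `ι† (y n t) = z t - δₙ Gₙ (z t)`, and the last term tends to
    -- zero.
    refine tendsto_nhds_unique (((adjoint ι).continuous.tendsto _).comp (hu htt)) ?_
    have := (tendsto_smul_smoothing hι (z t)).const_sub (z t)
    rw [sub_zero] at this
    refine this.congr fun n => ?_
    rw [sub_eq_iff_eq_add]
    exact ((isResolvent_smoothing ι n) (z t)).symm

end Existence

end FokkerPlanck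

namespace FokkerPlanck
open Filter
open scoped InnerProductSpace Topology

/-! ### Integration by parts for Lipschitz functions on the box. -/

section Box

variable {d : ℕ} {lo hi : Fin d → ℝ}

theorem ae_mem_nhds_box (lo hi : Fin d → ℝ) :
    ∀ᵐ x ∂(boxMeasure lo hi), Icc lo hi ∈ 𝓝 x := by
  have h : (univ.pi fun i => Ioo (lo i) (hi i)) =ᵐ[volume] Icc lo hi :=
    Measure.univ_pi_Ioo_ae_eq_Icc
  rw [boxMeasure, ← Measure.restrict_congr_set h]
  have hopen : IsOpen (univ.pi fun i => Ioo (lo i) (hi i)) :=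
    isOpen_set_pi finite_univ fun i _ => isOpen_Ioo
  filter_upwards [ae_restrict_mem hopen.measurableSet] with x hx
  refine mem_of_superset (hopen.mem_nhds hx) fun y hy => ⟨fun i => ?_, fun i => ?_⟩
  · exact (hy i (mem_univ i)).1.le
  · exact (hy i (mem_univ i)).2.le

theorem ae_differentiableAt_of_lipschitzOnWith {g : (Fin d → ℝ) → ℝ} {K : NNReal}
    (hg : LipschitzOnWith K g (Icc lo hi)) :
    ∀ᵐ x ∂(boxMeasure lo hi), DifferentiableAt ℝ g x := by
  filter_upwards [ae_mem_nhds_box lo hi, ae_restrict_mem measurableSet_Icc,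
    ae_restrict_of_ae (hg.ae_differentiableWithinAt_of_mem (μ := volume))] with x h1 h2 h3
  exact (h3 h2).differentiableAt h1

theorem measurable_partialDeriv (i : Fin d) (g : (Fin d → ℝ) → ℝ) :
    Measurable (partialDeriv i g) :=
  measurable_fderiv_apply_const ℝ g (Pi.single i 1)

theorem integrable_partialDeriv {g : (Fin d → ℝ) → ℝ} {K : NNReal}
    (hg : LipschitzOnWith K g (Icc lo hi)) (i : Fin d) :
    Integrable (partialDeriv i g) (boxMeasure lo hi) := by
  refine Integrable.of_bound (measurable_partialDeriv i g).aestronglyMeasurable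
    (K * ‖(Pi.single i 1 : Fin d → ℝ)‖) ?_
  filter_upwards [ae_mem_nhds_box lo hi] with x hx
  exact ((fderiv ℝ g x).le_opNorm _).trans
    (by gcongr; exact norm_fderiv_le_of_lipschitzOn ℝ hx hg)

/-- The integral over the box of a partial derivative of a Lipschitz function which takes equal
values on opposite faces vanishes. -/
theorem integral_partialDeriv_eq_zero (hle : ∀ i, lo i ≤ hi i) {g : (Fin d → ℝ) → ℝ} {K : NNReal}
    (hg : LipschitzOnWith K g (Icc lo hi)) (i : Fin d)
    (hbd : ∀ x ∈ Icc lo hi, g (Function.update x i (hi i)) = g (Function.update x i (lo i))) :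
    ∫ x in Icc lo hi, partialDeriv i g x = 0 := by
  obtain _ | n := d
  · exact i.elim0
  -- Separate the `i`-th coordinate; by Fubini it is enough that the integral along almost every
  -- line parallel to that axis vanishes.
  let e := MeasurableEquiv.piFinSuccAbove (fun _ : Fin (n + 1) => ℝ) i
  have he : MeasurePreserving e.symm volume volume :=
    (volume_preserving_piFinSuccAbove (fun _ => ℝ) i).symm e
  have hes (p : ℝ × (Fin n → ℝ)) : e.symm p = i.insertNth p.1 p.2 := rfl
  let lo' : Fin n → ℝ := fun j => lo (i.succAbove j)
  let hi' : Fin n → ℝ := fun j => hi (i.succAbove j)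
  have hpre : e.symm ⁻¹' Icc lo hi = Icc (lo i) (hi i) ×ˢ Icc lo' hi' := by
    ext p
    rw [mem_preimage, hes, Fin.insertNth_mem_Icc]
    rfl
  have hmeas : (volume.restrict (Icc (lo i) (hi i))).prod (volume.restrict (Icc lo' hi')) =
      (volume : Measure (ℝ × (Fin n → ℝ))).restrict (e.symm ⁻¹' Icc lo hi) := by
    rw [Measure.prod_restrict, hpre]; rfl
  have hmp : MeasurePreserving e.symm
      ((volume.restrict (Icc (lo i) (hi i))).prod (volume.restrict (Icc lo' hi')))
      (volume.restrict (Icc lo hi)) := by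
    rw [hmeas]
    exact he.restrict_preimage measurableSet_Icc
  have hint := integrable_partialDeriv hg i
  rw [← hmp.integral_comp e.symm.measurableEmbedding,
    integral_prod_symm (fun p => partialDeriv i g (e.symm p))
      (hmp.integrable_comp_of_integrable hint)]
  refine integral_eq_zero_of_ae ?_
  -- By Rademacher and Fubini, on almost every line `g` is differentiable at almost every point, so
  -- there the slice derivative is the partial derivative.
  have hdiff : ∀ᵐ p ∂((volume.restrict (Icc (lo i) (hi i))).prod (volume.restrict (Icc lo' hi'))),
      DifferentiableAt ℝ g (e.symm p) :=
    hmp.quasiMeasurePreserving.ae (ae_differentiableAt_of_lipschitzOnWith hg)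
  have hdiff' := Measure.ae_ae_of_ae_prod
    ((Measure.measurePreserving_swap (μ := volume.restrict (Icc lo' hi'))
      (ν := volume.restrict (Icc (lo i) (hi i)))).quasiMeasurePreserving.ae hdiff)
  filter_upwards [hdiff', ae_restrict_mem measurableSet_Icc] with y hy hyI
  have hupd (s : ℝ) : (i.insertNth s y : Fin (n + 1) → ℝ) =
      Function.update (i.insertNth (lo i) y) i s := by
    rw [Fin.update_insertNth]
  have hmem {s : ℝ} (hs : s ∈ Icc (lo i) (hi i)) :
      (i.insertNth s y : Fin (n + 1) → ℝ) ∈ Icc lo hi := Fin.insertNth_mem_Icc.mpr ⟨hs, hyI⟩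
  have hlip : LipschitzOnWith K (fun s => g (i.insertNth s y)) (uIcc (lo i) (hi i)) := by
    rw [uIcc_of_le (hle i)]
    refine LipschitzOnWith.of_dist_le_mul fun s hs r hr => ?_
    refine (hg.dist_le_mul _ (hmem hs) _ (hmem hr)).trans (le_of_eq ?_)
    rw [Fin.dist_insertNth_insertNth, dist_self, max_eq_left dist_nonneg]
  have hftc := hlip.absolutelyContinuousOnInterval.integral_deriv_eq_sub
  have hzero : g (i.insertNth (hi i) y) - g (i.insertNth (lo i) y) = 0 := by
    have := hbd _ (hmem (left_mem_Icc.mpr (hle i)))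
    rw [← hupd, ← hupd] at this
    rw [this, sub_self]
  rw [hzero, intervalIntegral.integral_of_le (hle i), ← integral_Icc_eq_integral_Ioc] at hftc
  rw [Pi.zero_apply, ← hftc]
  refine integral_congr_ae ?_
  filter_upwards [hy] with s hs
  have h1 : HasDerivAt (fun s => (i.insertNth s y : Fin (n + 1) → ℝ)) (Pi.single i 1) s := by
    rw [show (fun s => (i.insertNth s y : Fin (n + 1) → ℝ)) =
      Function.update (i.insertNth (lo i) y : Fin (n + 1) → ℝ) i from funext hupd]
    exact hasDerivAt_update _ i s
  exact (HasFDerivAt.comp_hasDerivAt s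
    (hs : DifferentiableAt ℝ g (i.insertNth s y)).hasFDerivAt h1).deriv.symm

theorem lipschitzOnWith_mul_of_isCompact {X : Type*} [PseudoMetricSpace X] {s : Set X}
    (hs : IsCompact s) {f g : X → ℝ} {K L : NNReal} (hf : LipschitzOnWith K f s)
    (hg : LipschitzOnWith L g s) : ∃ M, LipschitzOnWith M (fun x => f x * g x) s := by
  obtain ⟨C, hC⟩ := hs.exists_bound_of_continuousOn hf.continuousOn
  obtain ⟨D, hD⟩ := hs.exists_bound_of_continuousOn hg.continuousOn
  refine ⟨(C * L + K * D).toNNReal, LipschitzOnWith.of_dist_le_mul fun x hx y hy => ?_⟩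
  have h1 := hf.dist_le_mul x hx y hy
  have h2 := hg.dist_le_mul x hx y hy
  rw [Real.dist_eq] at h1 h2 ⊢
  have h3 : f x * g x - f y * g y = f x * (g x - g y) + (f x - f y) * g y := by ring
  calc _ ≤ |f x| * |g x - g y| + |f x - f y| * |g y| := by
        rw [h3, ← abs_mul, ← abs_mul]; exact abs_add_le _ _
    _ ≤ C * (L * dist x y) + (K * dist x y) * D := by
        have := hC x hx
        have := hD y hy
        have : 0 ≤ C := (norm_nonneg _).trans (hC x hx)
        gcongr <;> assumption
    _ = (C * L + K * D) * dist x y := by ring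
    _ ≤ _ := by gcongr; exact Real.le_coe_toNNReal _

theorem IsTestFunction.contDiff {bc : BoundaryCondition} {φ : (Fin d → ℝ) → ℝ}
    (h : IsTestFunction lo hi bc φ) : ContDiff ℝ ∞ φ := by
  cases bc
  · exact h.1
  · exact h

theorem IsTestFunction.exists_lipschitzOnWith {bc : BoundaryCondition} {φ : (Fin d → ℝ) → ℝ}
    (h : IsTestFunction lo hi bc φ) : ∃ K, LipschitzOnWith K φ (Icc lo hi) :=
  h.contDiff.contDiffOn.exists_lipschitzOnWith (by simp) (convex_Icc lo hi) isCompact_Icc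

theorem IsBoxPeriodic.update_eq {E : Type*} {f : (Fin d → ℝ) → E} (h : IsBoxPeriodic lo hi f)
    (x : Fin d → ℝ) (i : Fin d) :
    f (Function.update x i (hi i)) = f (Function.update x i (lo i)) := by
  rw [← h i (Function.update x i (lo i))]
  congr 1
  ext j
  by_cases hj : j = i
  · subst hj; simp
  · simp [hj]

/-- A divergence free Lipschitz field satisfying the boundary condition is orthogonal to
gradients. -/
theorem integral_sum_mul_partialDeriv_eq_zero (hle : ∀ i, lo i ≤ hi i) {bc : BoundaryCondition}
    {v : (Fin d → ℝ) → (Fin d → ℝ)} (hv : LocallyLipschitzOn (Icc lo hi) v)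
    (hdiv : ∀ᵐ x ∂(boxMeasure lo hi), ∑ i, partialDeriv i (fun y => v y i) x = 0)
    (hbd : FieldBoundary lo hi bc v) {φ : (Fin d → ℝ) → ℝ} (hφ : IsTestFunction lo hi bc φ) :
    ∫ x in Icc lo hi, ∑ i, v x i * partialDeriv i φ x = 0 := by
  obtain ⟨K, hK⟩ := hv.exists_lipschitzOnWith_of_compact isCompact_Icc
  obtain ⟨L, hL⟩ := hφ.exists_lipschitzOnWith
  have hKi (i : Fin d) : LipschitzOnWith K (fun x => v x i) (Icc lo hi) :=
    LipschitzOnWith.of_dist_le_mul fun x hx y hy =>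
      (dist_le_pi_dist (v x) (v y) i).trans (hK.dist_le_mul x hx y hy)
  choose M hM using fun i => lipschitzOnWith_mul_of_isCompact isCompact_Icc (hKi i) hL
  -- The flux `vᵢ φ` agrees on opposite faces by periodicity, or vanishes on both by tangency.
  have hzero (i : Fin d) : ∫ x in Icc lo hi, partialDeriv i (fun x => v x i * φ x) x = 0 := by
    refine integral_partialDeriv_eq_zero hle (hM i) i fun x hx => ?_
    cases bc with
    | periodic =>
      have h1 := congrFun (IsBoxPeriodic.update_eq hbd x i) i
      simp only [h1, IsBoxPeriodic.update_eq hφ.2 x i]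
    | neumann =>
      have hu {c : ℝ} (hc : c ∈ Icc (lo i) (hi i)) : Function.update x i c ∈ Icc lo hi := by
        refine ⟨fun j => ?_, fun j => ?_⟩ <;> by_cases hj : j = i
        · subst hj; simpa using hc.1
        · simpa [hj] using hx.1 j
        · subst hj; simpa using hc.2
        · simpa [hj] using hx.2 j
      have h1 := hbd _ (hu (left_mem_Icc.mpr (hle i))) i (by simp)
      have h2 := hbd _ (hu (right_mem_Icc.mpr (hle i))) i (by simp)
      simp only [h1, h2, zero_mul]
  have hsum : ∫ x in Icc lo hi, ∑ i, partialDeriv i (fun x => v x i * φ x) x = 0 := by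
    rw [integral_finsetSum _ fun i _ => integrable_partialDeriv (hM i) i]
    exact Finset.sum_eq_zero fun i _ => hzero i
  rw [← hsum]
  -- Almost everywhere `div (φ v) = v · ∇φ + φ div v`, and the last term is zero.
  refine integral_congr_ae ?_
  filter_upwards [hdiv, ae_all_iff.mpr fun i => ae_differentiableAt_of_lipschitzOnWith (hKi i)]
    with x h1 h2
  have h3 : DifferentiableAt ℝ φ x := hφ.contDiff.differentiable (by simp) x
  have h4 (i : Fin d) : partialDeriv i (fun x => v x i * φ x) x =
      v x i * partialDeriv i φ x + φ x * partialDeriv i (fun y => v y i) x := by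
    simp only [partialDeriv]
    rw [fderiv_fun_mul (h2 i) h3]
    simp
  simp_rw [h4]
  rw [Finset.sum_add_distrib, ← Finset.mul_sum, h1, mul_zero, add_zero]

end Box

end FokkerPlanck

namespace FokkerPlanck
open Filter
open scoped InnerProductSpace Topology ENNReal

/-! ### Poincaré inequality on the box. -/

section Poincare

variable {d : ℕ} {lo hi : Fin d → ℝ}

/-- The map `x ↦ s x + (1 - s) y` preserves the convex box and has Jacobian `s ^ d ≥ 2 ^ (-d)`. -/
theorem lintegral_comp_smul_add_le {F : (Fin d → ℝ) → ℝ≥0∞} (hF : Measurable F) {s : ℝ}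
    (hs : s ∈ Icc (1 / 2 : ℝ) 1) {y : Fin d → ℝ} (hy : y ∈ Icc lo hi) :
    ∫⁻ x in Icc lo hi, F (s • x + (1 - s) • y) ≤ 2 ^ d * ∫⁻ x in Icc lo hi, F x := by
  have hs0 : 0 < s := by linarith [hs.1]
  let G : (Fin d → ℝ) → ℝ≥0∞ := (Icc lo hi).indicator F
  have hG : Measurable G := hF.indicator measurableSet_Icc
  have hGadd : Measurable fun x => G (x + (1 - s) • y) := hG.comp (measurable_add_const _)
  calc ∫⁻ x in Icc lo hi, F (s • x + (1 - s) • y)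
      = ∫⁻ x in Icc lo hi, G (s • x + (1 - s) • y) := by
        refine setLIntegral_congr_fun measurableSet_Icc fun x hx => ?_
        have : s • x + (1 - s) • y ∈ Icc lo hi :=
          (convex_Icc lo hi) hx hy hs0.le (by linarith [hs.2]) (by ring)
        simp only [G, indicator_of_mem this]
    _ ≤ ∫⁻ x, G (s • x + (1 - s) • y) := setLIntegral_le_lintegral _ _
    _ = ∫⁻ x, G (x + (1 - s) • y) ∂(Measure.map (s • ·) volume) :=
        (lintegral_map hGadd (measurable_const_smul s)).symm
    _ = ENNReal.ofReal |(s ^ d)⁻¹| * ∫⁻ x, G (x + (1 - s) • y) := by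
        rw [Measure.map_addHaar_smul volume hs0.ne', lintegral_smul_measure, smul_eq_mul,
          Module.finrank_fin_fun]
    _ = ENNReal.ofReal |(s ^ d)⁻¹| * ∫⁻ x in Icc lo hi, F x := by
        rw [lintegral_add_right_eq_self, lintegral_indicator measurableSet_Icc]
    _ ≤ _ := by
        gcongr
        have h2 : |(s ^ d)⁻¹| ≤ 2 ^ d := by
          rw [abs_of_nonneg (by positivity), ← inv_pow]
          gcongr
          rw [inv_le_comm₀ hs0 two_pos]
          linarith [hs.1]
        refine (ENNReal.ofReal_le_ofReal h2).trans (le_of_eq ?_)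
        rw [ENNReal.ofReal_pow (by norm_num)]
        norm_num

/-- One of `s`, `1 - s` is at least `1/2`; exchanging `x` and `y` avoids the Jacobian degenerating
as `s → 0`. -/
theorem lintegral_lintegral_comp_segment_le {F : (Fin d → ℝ) → ℝ≥0∞} (hF : Measurable F) {s : ℝ}
    (hs : s ∈ Icc (0 : ℝ) 1) :
    ∫⁻ y in Icc lo hi, ∫⁻ x in Icc lo hi, F (s • x + (1 - s) • y) ≤
      2 ^ d * (∫⁻ x in Icc lo hi, F x) * volume (Icc lo hi) := by
  have key {r : ℝ} (hr : r ∈ Icc (1 / 2 : ℝ) 1) :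
      ∫⁻ y in Icc lo hi, ∫⁻ x in Icc lo hi, F (r • x + (1 - r) • y) ≤
      2 ^ d * (∫⁻ x in Icc lo hi, F x) * volume (Icc lo hi) := by
    calc _ ≤ ∫⁻ y in Icc lo hi, 2 ^ d * ∫⁻ x in Icc lo hi, F x :=
          setLIntegral_mono' measurableSet_Icc fun y hy => lintegral_comp_smul_add_le hF hr hy
      _ = _ := setLIntegral_const _ _
  rcases le_total (1 / 2) s with h | h
  · exact key ⟨h, hs.2⟩
  · rw [lintegral_lintegral_swap]
    · have := key (r := 1 - s) ⟨by linarith, by linarith [hs.1]⟩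
      simp only [sub_sub_cancel] at this
      refine le_trans (le_of_eq ?_) this
      simp_rw [add_comm]
    · refine Measurable.aemeasurable ?_
      exact hF.comp (by fun_prop)

theorem sq_intervalIntegral_le {h : ℝ → ℝ} (hh : Continuous h) :
    (∫ s in (0 : ℝ)..1, h s) ^ 2 ≤ ∫ s in (0 : ℝ)..1, h s ^ 2 := by
  set c := ∫ s in (0 : ℝ)..1, h s with hc
  have h1 : 0 ≤ ∫ s in (0 : ℝ)..1, (h s - c) ^ 2 :=
    intervalIntegral.integral_nonneg zero_le_one fun s _ => sq_nonneg _
  have h2 : ∫ s in (0 : ℝ)..1, (h s - c) ^ 2 = (∫ s in (0 : ℝ)..1, h s ^ 2) - c ^ 2 := by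
    have : ∀ s, (h s - c) ^ 2 = h s ^ 2 - 2 * c * h s + c ^ 2 := fun s => by ring
    simp_rw [this]
    rw [intervalIntegral.integral_add, intervalIntegral.integral_sub,
      intervalIntegral.integral_const_mul, ← hc]
    · simp; ring
    all_goals exact Continuous.intervalIntegrable (by fun_prop) _ _
  linarith

theorem continuous_partialDeriv {φ : (Fin d → ℝ) → ℝ} (hφ : ContDiff ℝ 1 φ) (i : Fin d) :
    Continuous (partialDeriv i φ) :=
  (hφ.continuous_fderiv one_ne_zero).clm_apply continuous_const

theorem fderiv_apply_eq_sum (φ : (Fin d → ℝ) → ℝ) (x v : Fin d → ℝ) :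
    fderiv ℝ φ x v = ∑ i, partialDeriv i φ x * v i := by
  conv_lhs => rw [pi_eq_sum_univ' v]
  simp only [map_sum, map_smul, partialDeriv, smul_eq_mul]
  refine Finset.sum_congr rfl fun i _ => ?_
  rw [mul_comm]

/-- Fundamental theorem of calculus along the segment from `y` to `x`, then Cauchy–Schwarz in `s`
and over the coordinates. -/
theorem sq_sub_le_integral {φ : (Fin d → ℝ) → ℝ} (hφ : ContDiff ℝ 1 φ) {x y : Fin d → ℝ}
    (hx : x ∈ Icc lo hi) (hy : y ∈ Icc lo hi) :
    (φ x - φ y) ^ 2 ≤ (∑ i, (hi i - lo i) ^ 2) *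
      ∫ s in (0 : ℝ)..1, ∑ i, partialDeriv i φ (s • x + (1 - s) • y) ^ 2 := by
  let γ (s : ℝ) : Fin d → ℝ := s • x + (1 - s) • y
  have hγ (s : ℝ) : HasDerivAt γ (x - y) s := by
    have h1 := ((hasDerivAt_id s).smul_const x).add
      (((hasDerivAt_id s).const_sub 1).smul_const y)
    convert! h1 using 1
    simp [sub_eq_add_neg]
  have hγc : Continuous γ := by fun_prop
  have hder (s : ℝ) : HasDerivAt (fun s => φ (γ s))
      (∑ i, partialDeriv i φ (γ s) * (x i - y i)) s := by
    have := ((hφ.differentiable one_ne_zero (γ s)).hasFDerivAt).comp_hasDerivAt s (hγ s)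
    rwa [fderiv_apply_eq_sum] at this
  have hpc (i : Fin d) : Continuous fun s => partialDeriv i φ (γ s) :=
    (continuous_partialDeriv hφ i).comp hγc
  have hftc := intervalIntegral.integral_eq_sub_of_hasDerivAt (a := 0) (b := 1)
    (fun s _ => hder s) (Continuous.intervalIntegrable (by fun_prop) _ _)
  have h0 : γ 0 = y := by simp [γ]
  have h1 : γ 1 = x := by simp [γ]
  rw [h0, h1] at hftc
  rw [← hftc, ← intervalIntegral.integral_const_mul]
  refine (sq_intervalIntegral_le (by fun_prop)).trans ?_
  refine intervalIntegral.integral_mono_on zero_le_one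
    (Continuous.intervalIntegrable (by fun_prop) _ _)
    (Continuous.intervalIntegrable (by fun_prop) _ _) fun s _ => ?_
  refine (Finset.sum_mul_sq_le_sq_mul_sq _ _ _).trans ?_
  rw [mul_comm]
  refine mul_le_mul_of_nonneg_right ?_ (Finset.sum_nonneg fun i _ => sq_nonneg _)
  refine Finset.sum_le_sum fun i _ => ?_
  rw [← sq_abs (x i - y i)]
  gcongr
  exact abs_sub_le_iff.mpr ⟨by linarith [hx.2 i, hy.1 i], by linarith [hx.1 i, hy.2 i]⟩

theorem lintegral_lintegral_sq_sub_le {φ : (Fin d → ℝ) → ℝ} (hφ : ContDiff ℝ 1 φ) :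
    ∫⁻ y in Icc lo hi, ∫⁻ x in Icc lo hi, ENNReal.ofReal ((φ x - φ y) ^ 2) ≤
      ENNReal.ofReal (∑ i, (hi i - lo i) ^ 2) * (2 ^ d *
        (∫⁻ x in Icc lo hi, ENNReal.ofReal (∑ i, partialDeriv i φ x ^ 2)) *
          volume (Icc lo hi)) := by
  have hpc := continuous_partialDeriv hφ
  let q (x : Fin d → ℝ) : ℝ := ∑ i, partialDeriv i φ x ^ 2
  have hq : Continuous q := by fun_prop
  have hq0 (x : Fin d → ℝ) : 0 ≤ q x := Finset.sum_nonneg fun i _ => sq_nonneg _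
  let F (x : Fin d → ℝ) : ℝ≥0∞ := ENNReal.ofReal (q x)
  have hF : Measurable F := hq.measurable.ennreal_ofReal
  set A := ENNReal.ofReal (∑ i, (hi i - lo i) ^ 2) with hA
  have hD : 0 ≤ ∑ i, (hi i - lo i) ^ 2 := Finset.sum_nonneg fun i _ => sq_nonneg _
  have hpt {x y : Fin d → ℝ} (hx : x ∈ Icc lo hi) (hy : y ∈ Icc lo hi) :
      ENNReal.ofReal ((φ x - φ y) ^ 2) ≤
        A * ∫⁻ s in Icc (0 : ℝ) 1, F (s • x + (1 - s) • y) := by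
    have h1 := ENNReal.ofReal_le_ofReal (sq_sub_le_integral hφ hx hy)
    rw [ENNReal.ofReal_mul hD, intervalIntegral.integral_of_le zero_le_one,
      ← integral_Icc_eq_integral_Ioc, ofReal_integral_eq_lintegral_ofReal] at h1
    · exact h1
    · exact Continuous.integrableOn_Icc (by fun_prop)
    · exact Eventually.of_forall fun s => hq0 _
  calc _ ≤ ∫⁻ y in Icc lo hi, ∫⁻ x in Icc lo hi,
        A * ∫⁻ s in Icc (0 : ℝ) 1, F (s • x + (1 - s) • y) :=
        setLIntegral_mono' measurableSet_Icc fun y hy =>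
          setLIntegral_mono' measurableSet_Icc fun x hx => hpt hx hy
    _ = A * ∫⁻ y in Icc lo hi, ∫⁻ x in Icc lo hi, ∫⁻ s in Icc (0 : ℝ) 1,
        F (s • x + (1 - s) • y) := by
        simp_rw [lintegral_const_mul' A _ ENNReal.ofReal_ne_top]
    _ = A * ∫⁻ s in Icc (0 : ℝ) 1, ∫⁻ y in Icc lo hi, ∫⁻ x in Icc lo hi,
        F (s • x + (1 - s) • y) := by
        congr 1
        have h1 (y : Fin d → ℝ) : ∫⁻ x in Icc lo hi, ∫⁻ s in Icc (0 : ℝ) 1,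
            F (s • x + (1 - s) • y) = ∫⁻ s in Icc (0 : ℝ) 1, ∫⁻ x in Icc lo hi,
            F (s • x + (1 - s) • y) :=
          lintegral_lintegral_swap (hF.comp (by fun_prop)).aemeasurable
        simp_rw [h1]
        refine lintegral_lintegral_swap (Measurable.aemeasurable ?_)
        have h2 : Measurable fun p : ((Fin d → ℝ) × ℝ) × (Fin d → ℝ) =>
            F (p.1.2 • p.2 + (1 - p.1.2) • p.1.1) := hF.comp (by fun_prop)
        exact h2.lintegral_prod_right'
    _ ≤ A * ∫⁻ s in Icc (0 : ℝ) 1, 2 ^ d * (∫⁻ x in Icc lo hi, F x) * volume (Icc lo hi) := by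
        gcongr A * ?_
        exact setLIntegral_mono' measurableSet_Icc fun s hs =>
          lintegral_lintegral_comp_segment_le hF hs
    _ = _ := by rw [setLIntegral_const]; simp [F, q]

/-- The Poincaré inequality on the box for continuously differentiable functions. -/
theorem variance_le_of_contDiff (lo hi : Fin d → ℝ) : ∃ C : ℝ, 0 < C ∧
    ∀ φ : (Fin d → ℝ) → ℝ, ContDiff ℝ 1 φ →
      (volume (Icc lo hi)).toReal * (∫ x in Icc lo hi, φ x ^ 2) - (∫ x in Icc lo hi, φ x) ^ 2 ≤
        C * ∑ i, ∫ x in Icc lo hi, partialDeriv i φ x ^ 2 := by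
  set m := (volume (Icc lo hi)).toReal with hm
  have hfin : volume (Icc lo hi) ≠ ⊤ := isCompact_Icc.measure_lt_top.ne
  -- The summand `1` only keeps the constant positive when `d = 0` or the box is null.
  refine ⟨(∑ i, (hi i - lo i) ^ 2) * (2 ^ d * m) + 1, by positivity, fun φ hφ => ?_⟩
  have hφc := hφ.continuous
  have hpc := continuous_partialDeriv hφ
  let q (x : Fin d → ℝ) : ℝ := ∑ i, partialDeriv i φ x ^ 2
  have hq : Continuous q := by fun_prop
  have hq0 (x : Fin d → ℝ) : 0 ≤ q x := Finset.sum_nonneg fun i _ => sq_nonneg _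
  have hQ : ∑ i, ∫ x in Icc lo hi, partialDeriv i φ x ^ 2 = ∫ x in Icc lo hi, q x := by
    rw [integral_finsetSum]
    intro i _
    exact Continuous.integrableOn_Icc (by fun_prop)
  have hQ0 : 0 ≤ ∫ x in Icc lo hi, q x := integral_nonneg hq0
  have hD : 0 ≤ ∑ i, (hi i - lo i) ^ 2 := Finset.sum_nonneg fun i _ => sq_nonneg _
  have hm0 : 0 ≤ m := ENNReal.toReal_nonneg
  have hinner (y : Fin d → ℝ) : ∫ x in Icc lo hi, (φ x - φ y) ^ 2 =
      (∫ x in Icc lo hi, φ x ^ 2) - 2 * φ y * (∫ x in Icc lo hi, φ x) + m * φ y ^ 2 := by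
    have : ∀ x, (φ x - φ y) ^ 2 = φ x ^ 2 - 2 * φ y * φ x + φ y ^ 2 := fun x => by ring
    simp_rw [this]
    rw [integral_add, integral_sub, integral_const_mul, setIntegral_const]
    · rfl
    all_goals exact Continuous.integrableOn_Icc (by fun_prop)
  -- The double integral is twice the variance term, which turns the segment estimate into the
  -- Poincaré inequality.
  have houter : ∫ y in Icc lo hi, ∫ x in Icc lo hi, (φ x - φ y) ^ 2 =
      2 * (m * (∫ x in Icc lo hi, φ x ^ 2) - (∫ x in Icc lo hi, φ x) ^ 2) := by
    simp_rw [hinner]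
    rw [integral_add, integral_sub, integral_const_mul, setIntegral_const, integral_mul_const,
      integral_const_mul, smul_eq_mul]
    · change m * _ - _ + _ = _
      ring
    all_goals exact Continuous.integrableOn_Icc (by fun_prop)
  have hlint := lintegral_lintegral_sq_sub_le (lo := lo) (hi := hi) hφ
  have hc (y : Fin d → ℝ) : ∫⁻ x in Icc lo hi, ENNReal.ofReal ((φ x - φ y) ^ 2) =
      ENNReal.ofReal (∫ x in Icc lo hi, (φ x - φ y) ^ 2) := by
    rw [ofReal_integral_eq_lintegral_ofReal]
    · exact Continuous.integrableOn_Icc (by fun_prop)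
    · exact Eventually.of_forall fun x => sq_nonneg _
  simp_rw [hc] at hlint
  rw [← ofReal_integral_eq_lintegral_ofReal, ← ofReal_integral_eq_lintegral_ofReal, houter] at hlint
  · have h2 : (2 : ℝ≥0∞) ^ d = ENNReal.ofReal (2 ^ d) := by
      rw [ENNReal.ofReal_pow (by norm_num)]; norm_num
    rw [h2, ← ENNReal.ofReal_toReal hfin, ← hm, ← ENNReal.ofReal_mul (by positivity),
      ← ENNReal.ofReal_mul (by positivity), ← ENNReal.ofReal_mul hD,
      ENNReal.ofReal_le_ofReal_iff (by positivity)] at hlint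
    rw [hQ]
    have h3 : 0 ≤ (∑ i, (hi i - lo i) ^ 2) * (2 ^ d * (∫ x in Icc lo hi, q x) * m) := by
      positivity
    change _ ≤ (∑ i, (hi i - lo i) ^ 2) * (2 ^ d * (∫ x in Icc lo hi, q x) * m) at hlint
    linarith
  · exact Continuous.integrableOn_Icc hq
  · exact Eventually.of_forall hq0
  · simp_rw [hinner]
    exact Continuous.integrableOn_Icc (by fun_prop)
  · exact Eventually.of_forall fun y => integral_nonneg fun x => sq_nonneg _

end Poincare

end FokkerPlanck

namespace FokkerPlanck
open Filter
open scoped InnerProductSpace Topology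

/-! ### The Sobolev space as a closed space of pairs `(u, ∇u)`. -/

section Sobolev

variable {d : ℕ} {lo hi : Fin d → ℝ} {bc : BoundaryCondition}

theorem IsTestFunction.add {φ ψ : (Fin d → ℝ) → ℝ} (hφ : IsTestFunction lo hi bc φ)
    (hψ : IsTestFunction lo hi bc ψ) : IsTestFunction lo hi bc (φ + ψ) := by
  cases bc
  · exact ⟨hφ.1.add hψ.1, fun i x => by simp only [Pi.add_apply, hφ.2 i x, hψ.2 i x]⟩
  · exact hφ.contDiff.add hψ.contDiff

theorem IsTestFunction.mul {φ ψ : (Fin d → ℝ) → ℝ} (hφ : IsTestFunction lo hi bc φ)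
    (hψ : IsTestFunction lo hi bc ψ) : IsTestFunction lo hi bc (φ * ψ) := by
  cases bc
  · exact ⟨hφ.1.mul hψ.1, fun i x => by simp only [Pi.mul_apply, hφ.2 i x, hψ.2 i x]⟩
  · exact hφ.contDiff.mul hψ.contDiff

theorem isTestFunction_const (c : ℝ) : IsTestFunction lo hi bc fun _ => c := by
  cases bc
  · exact ⟨contDiff_const, fun _ _ => rfl⟩
  · exact (contDiff_const : ContDiff ℝ ∞ fun _ : Fin d → ℝ => c)

theorem IsTestFunction.contDiff_one {φ : (Fin d → ℝ) → ℝ} (hφ : IsTestFunction lo hi bc φ) :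
    ContDiff ℝ 1 φ := hφ.contDiff.of_le (by exact_mod_cast le_top)

theorem IsTestFunction.differentiable {φ : (Fin d → ℝ) → ℝ} (hφ : IsTestFunction lo hi bc φ) :
    Differentiable ℝ φ := hφ.contDiff.differentiable (by simp)

theorem memLp_box_of_continuous {f : (Fin d → ℝ) → ℝ} (hf : Continuous f) (p : ENNReal) :
    MemLp f p (boxMeasure lo hi) := by
  obtain ⟨C, hC⟩ := (isCompact_Icc (a := lo) (b := hi)).exists_bound_of_continuousOn hf.continuousOn
  refine MemLp.of_bound hf.aestronglyMeasurable C ?_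
  filter_upwards [ae_restrict_mem measurableSet_Icc] with x hx using hC x hx

/-- The pairs consisting of a test function and its gradient. -/
def testGraph (lo hi : Fin d → ℝ) (bc : BoundaryCondition) :
    Submodule ℝ (L2 lo hi × (Fin d → L2 lo hi)) where
  carrier := {p | ∃ φ : (Fin d → ℝ) → ℝ, IsTestFunction lo hi bc φ ∧
      p.1 =ᵐ[boxMeasure lo hi] φ ∧ ∀ i, p.2 i =ᵐ[boxMeasure lo hi] partialDeriv i φ}
  add_mem' := by
    rintro p q ⟨φ, hφ, hp, hp'⟩ ⟨ψ, hψ, hq, hq'⟩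
    refine ⟨φ + ψ, hφ.add hψ, ?_, fun i => ?_⟩
    · exact (Lp.coeFn_add _ _).trans (hp.add hq)
    · refine (Lp.coeFn_add _ _).trans (((hp' i).add (hq' i)).trans (Eventually.of_forall fun x => ?_))
      simp [partialDeriv, fderiv_add (hφ.differentiable x) (hψ.differentiable x)]
  zero_mem' := by
    refine ⟨fun _ => 0, isTestFunction_const 0, Lp.coeFn_zero _ _ _, fun i => ?_⟩
    refine (Lp.coeFn_zero _ _ _).trans (Eventually.of_forall fun x => ?_)
    simp [partialDeriv]
  smul_mem' := by
    rintro c p ⟨φ, hφ, hp, hp'⟩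
    refine ⟨(fun _ => c) * φ, (isTestFunction_const c).mul hφ, ?_, fun i => ?_⟩
    · exact (Lp.coeFn_smul _ _).trans (hp.const_smul c)
    · refine (Lp.coeFn_smul _ _).trans (((hp' i).const_smul c).trans (Eventually.of_forall fun x => ?_))
      have : ((fun _ => c) * φ) = fun x => c * φ x := rfl
      simp [partialDeriv, this, fderiv_const_mul (hφ.differentiable x)]

/-- The Hilbert space of functions together with the components of a vector field. -/
abbrev Jet (lo hi : Fin d → ℝ) : Type := PiLp 2 (fun _ : Option (Fin d) => L2 lo hi)

/-- The function and the vector field underlying a jet. -/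
noncomputable def Jet.unpack (lo hi : Fin d → ℝ) : Jet lo hi →L[ℝ] L2 lo hi × (Fin d → L2 lo hi) :=
  (PiLp.proj 2 (fun _ : Option (Fin d) => L2 lo hi) none).prod
    (ContinuousLinearMap.pi fun i => PiLp.proj 2 (fun _ : Option (Fin d) => L2 lo hi) (some i))

/-- The jet with given function and vector field. -/
noncomputable def Jet.pack (p : L2 lo hi × (Fin d → L2 lo hi)) : Jet lo hi :=
  WithLp.toLp 2 fun o => o.elim p.1 p.2

theorem Jet.continuous_pack : Continuous (Jet.pack (lo := lo) (hi := hi)) := by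
  refine (PiLp.continuous_toLp 2 _).comp (continuous_pi fun o => ?_)
  cases o with
  | none => exact continuous_fst
  | some i => exact (continuous_apply i).comp continuous_snd

theorem Jet.pack_unpack (U : Jet lo hi) : Jet.pack (Jet.unpack lo hi U) = U := by
  ext o : 1
  cases o <;> rfl

/-- The Sobolev space of the boundary condition, with the gradient as part of the data. -/
noncomputable def sobolev (lo hi : Fin d → ℝ) (bc : BoundaryCondition) : Submodule ℝ (Jet lo hi) :=
  (testGraph lo hi bc).topologicalClosure.comap (Jet.unpack lo hi).toLinearMap

theorem isClosed_sobolev : IsClosed (sobolev lo hi bc : Set (Jet lo hi)) :=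
  (Submodule.isClosed_topologicalClosure _).preimage (Jet.unpack lo hi).continuous

instance : CompleteSpace (sobolev lo hi bc) := isClosed_sobolev.completeSpace_coe

/-- The embedding of the Sobolev space into `L²`. -/
noncomputable def embed (lo hi : Fin d → ℝ) (bc : BoundaryCondition) :
    sobolev lo hi bc →L[ℝ] L2 lo hi :=
  PiLp.proj 2 (fun _ : Option (Fin d) => L2 lo hi) none ∘L (sobolev lo hi bc).subtypeL

/-- The weak partial derivatives. -/
noncomputable def grad (lo hi : Fin d → ℝ) (bc : BoundaryCondition) (i : Fin d) :
    sobolev lo hi bc →L[ℝ] L2 lo hi :=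
  PiLp.proj 2 (fun _ : Option (Fin d) => L2 lo hi) (some i) ∘L (sobolev lo hi bc).subtypeL

theorem hasSobolevGradient_embed (U : sobolev lo hi bc) :
    HasSobolevGradient lo hi bc (embed lo hi bc U) fun i => grad lo hi bc i U := U.2

theorem HasSobolevGradient.pack_mem {u : L2 lo hi} {g : Fin d → L2 lo hi}
    (h : HasSobolevGradient lo hi bc u g) : Jet.pack (u, g) ∈ sobolev lo hi bc := h

theorem inner_sobolev (U W : sobolev lo hi bc) :
    ⟪U, W⟫_ℝ = ⟪embed lo hi bc U, embed lo hi bc W⟫_ℝ +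
      ∑ i, ⟪grad lo hi bc i U, grad lo hi bc i W⟫_ℝ := by
  rw [Submodule.coe_inner, PiLp.inner_apply, Fintype.sum_option]
  rfl

theorem norm_sq_sobolev (U : sobolev lo hi bc) :
    ‖U‖ ^ 2 = ‖embed lo hi bc U‖ ^ 2 + ∑ i, ‖grad lo hi bc i U‖ ^ 2 := by
  simp only [← real_inner_self_eq_norm_sq]
  exact inner_sobolev U U

/-- The class in `L²` of a continuous function. -/
noncomputable def toL2 (lo hi : Fin d → ℝ) {f : (Fin d → ℝ) → ℝ} (hf : Continuous f) : L2 lo hi :=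
  (memLp_box_of_continuous hf 2).toLp

theorem coeFn_toL2 {f : (Fin d → ℝ) → ℝ} (hf : Continuous f) :
    toL2 lo hi hf =ᵐ[boxMeasure lo hi] f := MemLp.coeFn_toLp _

theorem inner_toL2 (u : L2 lo hi) {f : (Fin d → ℝ) → ℝ} (hf : Continuous f) :
    ⟪u, toL2 lo hi hf⟫_ℝ = ∫ x in Icc lo hi, u x * f x := by
  rw [L2.inner_def]
  refine integral_congr_ae ?_
  filter_upwards [coeFn_toL2 hf] with x hx
  rw [hx]
  simp [mul_comm]

theorem inner_toL2_toL2 {f g : (Fin d → ℝ) → ℝ} (hf : Continuous f) (hg : Continuous g) :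
    ⟪toL2 lo hi hf, toL2 lo hi hg⟫_ℝ = ∫ x in Icc lo hi, f x * g x := by
  rw [inner_toL2]
  refine integral_congr_ae ?_
  filter_upwards [coeFn_toL2 hf] with x hx
  rw [hx]

namespace IsTestFunction

/-- The element of the Sobolev space given by a test function. -/
noncomputable def jet {φ : (Fin d → ℝ) → ℝ} (hφ : IsTestFunction lo hi bc φ) :
    sobolev lo hi bc :=
  ⟨Jet.pack (toL2 lo hi hφ.contDiff.continuous,
    fun i => toL2 lo hi (continuous_partialDeriv hφ.contDiff_one i)),
    HasSobolevGradient.pack_mem (subset_closure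
      ⟨φ, hφ, coeFn_toL2 hφ.contDiff.continuous,
        fun i => coeFn_toL2 (continuous_partialDeriv hφ.contDiff_one i)⟩)⟩

theorem embed_jet {φ : (Fin d → ℝ) → ℝ} (hφ : IsTestFunction lo hi bc φ) :
    embed lo hi bc hφ.jet = toL2 lo hi hφ.contDiff.continuous := rfl

theorem grad_jet {φ : (Fin d → ℝ) → ℝ} (hφ : IsTestFunction lo hi bc φ) (i : Fin d) :
    grad lo hi bc i hφ.jet = toL2 lo hi (continuous_partialDeriv hφ.contDiff_one i) := rfl

end IsTestFunction

/-- Test functions are dense in the Sobolev space. -/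
theorem sobolev_induction {p : sobolev lo hi bc → Prop} (hp : IsClosed {U | p U})
    (h : ∀ φ (hφ : IsTestFunction lo hi bc φ), p hφ.jet) (U : sobolev lo hi bc) : p U := by
  have hU : Jet.unpack lo hi U.1 ∈ closure (testGraph lo hi bc : Set _) := U.2
  obtain ⟨x, hx, hxU⟩ := mem_closure_iff_seq_limit.mp hU
  choose φ hφ h1 h2 using hx
  have hjet (n : ℕ) : ((hφ n).jet : Jet lo hi) = Jet.pack (x n) := by
    change Jet.pack _ = _
    congr 1
    refine Prod.ext (Lp.ext ?_) (funext fun i => Lp.ext ?_)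
    · exact (coeFn_toL2 (hφ n).contDiff.continuous).trans (h1 n).symm
    · exact (coeFn_toL2 (continuous_partialDeriv (hφ n).contDiff_one i)).trans (h2 n i).symm
  have hlim : Tendsto (fun n => (hφ n).jet) atTop (𝓝 U) := by
    rw [tendsto_subtype_rng]
    simp_rw [hjet]
    have := (Jet.continuous_pack.tendsto _).comp hxU
    rwa [Jet.pack_unpack] at this
  exact hp.mem_of_tendsto hlim (Eventually.of_forall fun n => h _ (hφ n))

end Sobolev

end FokkerPlanck

namespace FokkerPlanck
open Filter
open scoped InnerProductSpace Topology

/-! ### Injectivity and dense range of the embedding into `L²`. -/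

section Density

variable {d : ℕ} {lo hi : Fin d → ℝ} {bc : BoundaryCondition}

/-- The interior of the box. -/
def openBox (lo hi : Fin d → ℝ) : Set (Fin d → ℝ) := univ.pi fun i => Ioo (lo i) (hi i)

theorem isOpen_openBox : IsOpen (openBox lo hi) := isOpen_set_pi finite_univ fun _ _ => isOpen_Ioo

theorem openBox_ae_eq : openBox lo hi =ᵐ[volume] Icc lo hi := Measure.univ_pi_Ioo_ae_eq_Icc

theorem openBox_subset : openBox lo hi ⊆ Icc lo hi :=
  fun _ hx => ⟨fun i => (hx i (mem_univ i)).1.le, fun i => (hx i (mem_univ i)).2.le⟩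

theorem setIntegral_box_of_tsupport_subset {f : (Fin d → ℝ) → ℝ}
    (hf : tsupport f ⊆ openBox lo hi) : ∫ x in Icc lo hi, f x = ∫ x, f x :=
  setIntegral_eq_integral_of_forall_compl_eq_zero fun _ hx =>
    image_eq_zero_of_notMem_tsupport fun h => hx (openBox_subset (hf h))

theorem eq_zero_of_forall_integral_mul_eq_zero (u : L2 lo hi)
    (h : ∀ ψ : (Fin d → ℝ) → ℝ, ContDiff ℝ ∞ ψ → HasCompactSupport ψ →
      tsupport ψ ⊆ openBox lo hi → ∫ x in Icc lo hi, u x * ψ x = 0) : u = 0 := by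
  have hint : IntegrableOn u (openBox lo hi) volume :=
    IntegrableOn.mono_set ((Lp.memLp u).integrable one_le_two) openBox_subset
  have h1 := isOpen_openBox.ae_eq_zero_of_integral_contDiff_smul_eq_zero (μ := volume)
    (f := u) hint.locallyIntegrableOn fun ψ hψ hψc hψs => by
      rw [← h ψ hψ hψc hψs, ← setIntegral_box_of_tsupport_subset (lo := lo) (hi := hi)]
      · simp_rw [smul_eq_mul, mul_comm]
      · exact (tsupport_smul_subset_left ψ u).trans hψs
  refine Lp.ext ?_
  have h2 : ∀ᵐ x ∂(boxMeasure lo hi), u x = 0 := by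
    have h3 : ∀ᵐ x ∂(volume.restrict (openBox lo hi)), u x = 0 :=
      (ae_restrict_iff' isOpen_openBox.measurableSet).mpr h1
    rwa [Measure.restrict_congr_set openBox_ae_eq] at h3
  filter_upwards [h2, Lp.coeFn_zero ℝ 2 (boxMeasure lo hi)] with x h3 h4
  rw [h3, h4]; rfl

theorem hasCompactSupport_partialDeriv {ψ : (Fin d → ℝ) → ℝ} (h : HasCompactSupport ψ)
    (i : Fin d) : HasCompactSupport (partialDeriv i ψ) :=
  (h.fderiv ℝ).comp_left (g := fun L : (Fin d → ℝ) →L[ℝ] ℝ => L (Pi.single i 1)) rfl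

/-- Integration by parts against smooth functions supported in the interior. -/
theorem inner_grad_eq {ψ : (Fin d → ℝ) → ℝ} (hψ : ContDiff ℝ ∞ ψ) (hψc : HasCompactSupport ψ)
    (hψs : tsupport ψ ⊆ openBox lo hi) (i : Fin d) (U : sobolev lo hi bc) :
    ⟪grad lo hi bc i U, toL2 lo hi hψ.continuous⟫_ℝ = -⟪embed lo hi bc U,
      toL2 lo hi (continuous_partialDeriv (hψ.of_le (by exact_mod_cast le_top)) i)⟫_ℝ := by
  have hψ1 : ContDiff ℝ 1 ψ := hψ.of_le (by exact_mod_cast le_top)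
  refine sobolev_induction (p := fun U => ⟪grad lo hi bc i U, toL2 lo hi hψ.continuous⟫_ℝ =
    -⟪embed lo hi bc U, toL2 lo hi (continuous_partialDeriv hψ1 i)⟫_ℝ)
    (isClosed_eq (by fun_prop) (by fun_prop)) (fun φ hφ => ?_) U
  have hφc := hφ.contDiff.continuous
  have hφp := continuous_partialDeriv hφ.contDiff_one i
  have hψp := continuous_partialDeriv hψ1 i
  rw [IsTestFunction.grad_jet, IsTestFunction.embed_jet, inner_toL2_toL2, inner_toL2_toL2,
    setIntegral_box_of_tsupport_subset, setIntegral_box_of_tsupport_subset]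
  · have := integral_mul_fderiv_eq_neg_fderiv_mul_of_integrable (μ := volume) (f := ψ) (g := φ)
      (v := Pi.single i 1) ?_ ?_ ?_ (fun x _ => hψ1.differentiable one_ne_zero x)
      (fun x _ => hφ.differentiable x)
    · simp only [partialDeriv]
      simp_rw [mul_comm (φ _), mul_comm _ (ψ _)]
      exact this
    · exact (hψp.mul hφc).integrable_of_hasCompactSupport
        (hasCompactSupport_partialDeriv hψc i).mul_right
    · exact (hψ.continuous.mul hφp).integrable_of_hasCompactSupport hψc.mul_right
    · exact (hψ.continuous.mul hφc).integrable_of_hasCompactSupport hψc.mul_right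
  · refine (tsupport_mul_subset_right).trans ?_
    refine (closure_mono ?_).trans ((tsupport_fderiv_subset ℝ).trans hψs)
    intro x hx hx'
    apply hx
    simp [partialDeriv, hx']
  · exact tsupport_mul_subset_right.trans hψs

/-- The gradient is part of the data, so this is closability: integration by parts against functions
supported in the interior shows that a limit gradient of the zero function is zero. -/
theorem embed_injective : Function.Injective (embed lo hi bc) := by
  rw [injective_iff_map_eq_zero]
  intro U hU
  have hg (i : Fin d) : grad lo hi bc i U = 0 := by
    refine eq_zero_of_forall_integral_mul_eq_zero _ fun ψ hψ hψc hψs => ?_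
    rw [← inner_toL2 _ hψ.continuous, inner_grad_eq hψ hψc hψs, hU, inner_zero_left, neg_zero]
  have := norm_sq_sobolev U
  simpa [hU, hg] using this

/-- Periodic extension of a function on the half-open box. -/
noncomputable def periodize (hX : ∀ i, lo i < hi i) (ψ : (Fin d → ℝ) → ℝ) (x : Fin d → ℝ) : ℝ :=
  ψ fun i => toIcoMod (sub_pos.mpr (hX i)) (lo i) (x i)

theorem isBoxPeriodic_periodize (hX : ∀ i, lo i < hi i) (ψ : (Fin d → ℝ) → ℝ) :
    IsBoxPeriodic lo hi (periodize hX ψ) := by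
  intro i x
  simp only [periodize]
  congr 1
  ext j
  by_cases hj : j = i
  · subst hj; simp
  · simp [hj]

theorem periodize_eq_self (hX : ∀ i, lo i < hi i) (ψ : (Fin d → ℝ) → ℝ) {x : Fin d → ℝ}
    (hx : x ∈ openBox lo hi) : periodize hX ψ x = ψ x := by
  simp only [periodize]
  congr 1
  ext i
  rw [toIcoMod_eq_self]
  have := hx i (mem_univ i)
  exact ⟨this.1.le, by linarith [this.2]⟩

/-- `ψ` vanishes near the faces, so its translates glue smoothly across them. -/
theorem contDiff_periodize (hX : ∀ i, lo i < hi i) {ψ : (Fin d → ℝ) → ℝ} (hψ : ContDiff ℝ ∞ ψ)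
    (hψc : HasCompactSupport ψ) (hψs : tsupport ψ ⊆ openBox lo hi) :
    ContDiff ℝ ∞ (periodize hX ψ) := by
  rw [contDiff_iff_contDiffAt]
  intro x
  let L (i : Fin d) : ℝ := hi i - lo i
  have hL (i : Fin d) : 0 < L i := sub_pos.mpr (hX i)
  -- The lattice vector that brings `x` into the half-open box; `x - c` can miss the open box only
  -- by lying on a lower face.
  let c : Fin d → ℝ := fun i => toIcoDiv (hL i) (lo i) (x i) • L i
  have hmod (i : Fin d) : toIcoMod (hL i) (lo i) (x i) = x i - c i := rfl
  by_cases hbox : (x - c) ∈ openBox lo hi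
  · -- near `x` the periodization is a translate
    have h1 : ContDiffAt ℝ ∞ (fun y => ψ (y - c)) x :=
      (hψ.comp (contDiff_id.sub contDiff_const)).contDiffAt
    refine h1.congr_of_eventuallyEq ?_
    have h2 : ∀ᶠ y in 𝓝 x, y - c ∈ openBox lo hi :=
      (continuous_id.sub continuous_const).continuousAt.eventually_mem
        (isOpen_openBox.mem_nhds hbox)
    filter_upwards [h2] with y hy
    simp only [periodize]
    congr 1
    ext i
    rw [toIcoMod_eq_iff]
    have := hy i (mem_univ i)
    refine ⟨⟨this.1.le, ?_⟩, toIcoDiv (hL i) (lo i) (x i), ?_⟩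
    · linarith [this.2]
    · simp [c, L]
  · -- near `x` the periodization vanishes
    obtain ⟨i, hi'⟩ : ∃ i, x i - c i = lo i := by
      by_contra! hcon
      apply hbox
      intro i _
      have := toIcoMod_mem_Ico (hL i) (lo i) (x i)
      rw [hmod] at this
      exact ⟨lt_of_le_of_ne this.1 (hcon i).symm, by have := this.2; simp [L] at this; exact this⟩
    obtain ⟨δ, hδ, hδψ⟩ : ∃ δ > 0, ∀ z, (z i < lo i + δ ∨ hi i - δ < z i) → ψ z = 0 := by
      have hcont : ContinuousOn (fun z : Fin d → ℝ => min (z i - lo i) (hi i - z i))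
          (tsupport ψ) := by fun_prop
      obtain ⟨δ, hδ, hδψ⟩ := IsCompact.exists_forall_le' (a := 0) hψc hcont fun z hz => by
        have := hψs hz i (mem_univ i)
        exact lt_min (by linarith [this.1]) (by linarith [this.2])
      refine ⟨δ, hδ, fun z hz => image_eq_zero_of_notMem_tsupport fun hzs => ?_⟩
      have h3 := le_min_iff.mp (hδψ z hzs)
      rcases hz with hz | hz
      · linarith [h3.1]
      · linarith [h3.2]
    have h1 : ContDiffAt ℝ ∞ (fun _ : Fin d → ℝ => (0 : ℝ)) x := contDiffAt_const
    refine h1.congr_of_eventuallyEq ?_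
    have h2 : ∀ᶠ y in 𝓝 x, |y i - x i| < min δ (L i) := by
      have : Continuous fun y : Fin d → ℝ => |y i - x i| := by fun_prop
      exact this.continuousAt.eventually_lt continuousAt_const (by simpa using ⟨hδ, hL i⟩)
    filter_upwards [h2] with y hy
    simp only [periodize]
    apply hδψ
    rw [lt_min_iff, abs_lt, abs_lt] at hy
    have hci : c i = toIcoDiv (hL i) (lo i) (x i) • L i := rfl
    -- To the right of `x` the reduced coordinate is just above `lo i`. To the left it wraps to just
    -- below `hi i`, and the quotient drops by one.
    rcases le_or_gt (x i) (y i) with hxy | hxy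
    · left
      have : toIcoMod (hL i) (lo i) (y i) = lo i + (y i - x i) := by
        rw [toIcoMod_eq_iff]
        refine ⟨⟨by linarith, by linarith [hy.2.2]⟩, toIcoDiv (hL i) (lo i) (x i), ?_⟩
        rw [← hci]; linarith
      refine (this.trans_lt ?_ : _ < _); linarith [hy.1.2]
    · right
      have : toIcoMod (hL i) (lo i) (y i) = hi i + (y i - x i) := by
        rw [toIcoMod_eq_iff]
        refine ⟨⟨?_, ?_⟩, toIcoDiv (hL i) (lo i) (x i) - 1, ?_⟩
        · have := hy.2.1; simp only [L] at this; linarith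
        · linarith
        · rw [sub_smul, ← hci]; simp only [L, one_smul]; linarith
      refine (lt_of_lt_of_eq ?_ this.symm : _ < _); linarith [hy.1.1]

theorem exists_isTestFunction_eqOn (hX : ∀ i, lo i < hi i) (bc : BoundaryCondition)
    {ψ : (Fin d → ℝ) → ℝ} (hψ : ContDiff ℝ ∞ ψ) (hψc : HasCompactSupport ψ)
    (hψs : tsupport ψ ⊆ openBox lo hi) :
    ∃ φ, IsTestFunction lo hi bc φ ∧ EqOn φ ψ (openBox lo hi) := by
  cases bc with
  | periodic =>
    exact ⟨periodize hX ψ, ⟨contDiff_periodize hX hψ hψc hψs, isBoxPeriodic_periodize hX ψ⟩,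
      fun x hx => periodize_eq_self hX ψ hx⟩
  | neumann => exact ⟨ψ, hψ, fun _ _ => rfl⟩

/-- Every smooth function supported in the interior agrees there with a test function, by
periodization if necessary, so a vector orthogonal to the range vanishes. -/
theorem denseRange_embed (hX : ∀ i, lo i < hi i) : DenseRange (embed lo hi bc) := by
  have h1 : (embed lo hi bc).range.topologicalClosure = ⊤ := by
    rw [Submodule.topologicalClosure_eq_top_iff, Submodule.eq_bot_iff]
    intro u hu
    refine eq_zero_of_forall_integral_mul_eq_zero _ fun ψ hψ hψc hψs => ?_
    obtain ⟨φ, hφ, hφψ⟩ := exists_isTestFunction_eqOn hX bc hψ hψc hψs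
    have h2 : ⟪u, embed lo hi bc hφ.jet⟫_ℝ = 0 :=
      Submodule.inner_left_of_mem_orthogonal
        (LinearMap.mem_range_self (embed lo hi bc).toLinearMap hφ.jet) hu
    rw [IsTestFunction.embed_jet, inner_toL2] at h2
    rw [← h2, ← setIntegral_congr_set openBox_ae_eq, ← setIntegral_congr_set openBox_ae_eq]
    exact setIntegral_congr_fun isOpen_openBox.measurableSet fun x hx => by rw [hφψ hx]
  exact Submodule.dense_iff_topologicalClosure_eq_top.mpr h1

end Density

end FokkerPlanck

namespace FokkerPlanck
open ContinuousLinearMap Filter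
open scoped InnerProductSpace Topology

/-! ### Contraction, decay and the solution operator. -/

section SolutionOperator

theorem integrable_norm_sq_sub {H V : Type*} [NormedAddCommGroup H] [NormedSpace ℝ H]
    [NormedAddCommGroup V] [NormedSpace ℝ V] {ι : V →L[ℝ] H} {t₀ t₁ : ℝ} {U : ℝ → V}
    (hU : MemLp U 2 (volume.restrict (Icc t₀ t₁))) :
    Integrable (fun s => ‖U s‖ ^ 2 - ‖ι (U s)‖ ^ 2) (volume.restrict (Icc t₀ t₁)) :=
  (hU.integrable_norm_pow two_ne_zero).sub
    ((ι.comp_memLp' hU).integrable_norm_pow two_ne_zero)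

variable {H V : Type*} [NormedAddCommGroup H] [InnerProductSpace ℝ H] [CompleteSpace H]
  [NormedAddCommGroup V] [InnerProductSpace ℝ V] [CompleteSpace V]
  {ι : V →L[ℝ] H} {a : ℝ → V →L[ℝ] V} {t₀ t₁ κ : ℝ}

namespace IsEvolution

theorem add (ha : ContinuousOn a (Icc t₀ t₁)) {u₀ v₀ : H} {u v : ℝ → H} {U W : ℝ → V}
    (hu : IsEvolution ι a t₀ t₁ u₀ u U) (hv : IsEvolution ι a t₀ t₁ v₀ v W) :
    IsEvolution ι a t₀ t₁ (u₀ + v₀) (u + v) (U + W) where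
  continuousOn := hu.continuousOn.add hv.continuousOn
  memLp := hu.memLp.add hv.memLp
  ae_eq := by
    filter_upwards [hu.ae_eq, hv.ae_eq] with s h1 h2
    simp [h1, h2]
  eq_integral t ht := by
    have h1 := intervalIntegrable_of_memLp (memLp_clm_apply ha hu.memLp) ht
    have h2 := intervalIntegrable_of_memLp (memLp_clm_apply ha hv.memLp) ht
    simp only [Pi.add_apply, map_add, hu.eq_integral t ht, hv.eq_integral t ht,
      intervalIntegral.integral_add h1 h2]
    abel

theorem smul (c : ℝ) {u₀ : H} {u : ℝ → H} {U : ℝ → V} (hu : IsEvolution ι a t₀ t₁ u₀ u U) :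
    IsEvolution ι a t₀ t₁ (c • u₀) (c • u) (c • U) where
  continuousOn := hu.continuousOn.const_smul c
  memLp := hu.memLp.const_smul c
  ae_eq := by
    filter_upwards [hu.ae_eq] with s h1
    simp [h1]
  eq_integral t ht := by
    simp only [Pi.smul_apply, map_smul, hu.eq_integral t ht, intervalIntegral.integral_smul,
      smul_sub]

theorem norm_sq_eq_integral (hι : Function.Injective ι) (hd : DenseRange ι)
    (ha : ContinuousOn a (Icc t₀ t₁))
    (hco : ∀ t ∈ Icc t₀ t₁, ∀ v, ⟪a t v, v⟫_ℝ = κ * (‖v‖ ^ 2 - ‖ι v‖ ^ 2)) {u₀ : H} {u : ℝ → H}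
    {U : ℝ → V} (h : IsEvolution ι a t₀ t₁ u₀ u U) {t : ℝ} (ht : t ∈ Icc t₀ t₁) :
    ‖u t‖ ^ 2 = ‖u₀‖ ^ 2 - 2 * κ * ∫ s in Icc t₀ t, (‖U s‖ ^ 2 - ‖ι (U s)‖ ^ 2) := by
  rw [h.norm_sq_eq hι hd ha ht, intervalIntegral.integral_of_le ht.1,
    ← integral_Icc_eq_integral_Ioc, mul_assoc, ← integral_const_mul κ]
  congr 2
  exact setIntegral_congr_fun measurableSet_Icc fun s hs => hco s ⟨hs.1, hs.2.trans ht.2⟩ (U s)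

theorem norm_sq_antitone (hι : Function.Injective ι) (hd : DenseRange ι)
    (hι1 : ∀ v, ‖ι v‖ ≤ ‖v‖) (hκ : 0 < κ) (ha : ContinuousOn a (Icc t₀ t₁))
    (hco : ∀ t ∈ Icc t₀ t₁, ∀ v, ⟪a t v, v⟫_ℝ = κ * (‖v‖ ^ 2 - ‖ι v‖ ^ 2)) {u₀ : H} {u : ℝ → H}
    {U : ℝ → V} (h : IsEvolution ι a t₀ t₁ u₀ u U) {s t : ℝ} (hs : s ∈ Icc t₀ t₁)
    (ht : t ∈ Icc t₀ t₁) (hst : s ≤ t) : ‖u t‖ ^ 2 ≤ ‖u s‖ ^ 2 := by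
  rw [h.norm_sq_eq_integral hι hd ha hco ht, h.norm_sq_eq_integral hι hd ha hco hs]
  gcongr ‖u₀‖ ^ 2 - 2 * κ * ?_
  refine setIntegral_mono_set
    (IntegrableOn.mono_set (integrable_norm_sq_sub h.memLp) (Icc_subset_Icc_right ht.2))
    (Eventually.of_forall fun r => ?_) (LE.le.eventuallyLE (Icc_subset_Icc_right hst))
  have := hι1 (U r)
  simp only [Pi.zero_apply, sub_nonneg]
  gcongr

theorem norm_le (hι : Function.Injective ι) (hd : DenseRange ι)
    (hι1 : ∀ v, ‖ι v‖ ≤ ‖v‖) (hκ : 0 < κ) (ha : ContinuousOn a (Icc t₀ t₁))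
    (hco : ∀ t ∈ Icc t₀ t₁, ∀ v, ⟪a t v, v⟫_ℝ = κ * (‖v‖ ^ 2 - ‖ι v‖ ^ 2)) {u₀ : H} {u : ℝ → H}
    {U : ℝ → V} (h : IsEvolution ι a t₀ t₁ u₀ u U) {t : ℝ} (ht : t ∈ Icc t₀ t₁) :
    ‖u t‖ ≤ ‖u₀‖ := by
  refine le_of_sq_le_sq ?_ (norm_nonneg _)
  rw [h.norm_sq_eq_integral hι hd ha hco ht]
  have : 0 ≤ ∫ s in Icc t₀ t, (‖U s‖ ^ 2 - ‖ι (U s)‖ ^ 2) := by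
    refine integral_nonneg fun s => ?_
    have := hι1 (U s)
    simp only [Pi.zero_apply, sub_nonneg]
    gcongr
  have := mul_nonneg hκ.le this
  linarith

/-- Decay of solutions which satisfy a Poincaré inequality. -/
theorem norm_sq_mul_le (hι : Function.Injective ι) (hd : DenseRange ι)
    (hι1 : ∀ v, ‖ι v‖ ≤ ‖v‖) (hκ : 0 < κ) (ht : t₀ ≤ t₁) (ha : ContinuousOn a (Icc t₀ t₁))
    (hco : ∀ t ∈ Icc t₀ t₁, ∀ v, ⟪a t v, v⟫_ℝ = κ * (‖v‖ ^ 2 - ‖ι v‖ ^ 2)) {u₀ : H} {u : ℝ → H}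
    {U : ℝ → V} (h : IsEvolution ι a t₀ t₁ u₀ u U) {c : ℝ} (hc : 0 ≤ c)
    (hP : ∀ᵐ s ∂(volume.restrict (Icc t₀ t₁)), c * ‖ι (U s)‖ ^ 2 ≤ ‖U s‖ ^ 2 - ‖ι (U s)‖ ^ 2) :
    (1 + 2 * κ * c * (t₁ - t₀)) * ‖u t₁‖ ^ 2 ≤ ‖u₀‖ ^ 2 := by
  have h1 := h.norm_sq_eq_integral hι hd ha hco (right_mem_Icc.mpr ht)
  -- As the norm is nonincreasing, the dissipation is at least `c ‖u t₁‖²` at almost every time.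
  -- This replaces Gronwall: any factor below one suffices.
  have h2 : ∫ _ in Icc t₀ t₁, c * ‖u t₁‖ ^ 2 ≤ ∫ s in Icc t₀ t₁, (‖U s‖ ^ 2 - ‖ι (U s)‖ ^ 2) := by
    refine integral_mono_ae (integrable_const _) (integrable_norm_sq_sub h.memLp) ?_
    filter_upwards [hP, h.ae_eq, ae_restrict_mem measurableSet_Icc] with s h3 h4 h5
    refine le_trans ?_ h3
    rw [← h4]
    exact mul_le_mul_of_nonneg_left
      (h.norm_sq_antitone hι hd hι1 hκ ha hco h5 (right_mem_Icc.mpr ht) h5.2) hc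
  rw [setIntegral_const, measureReal_def, Real.volume_Icc,
    ENNReal.toReal_ofReal (sub_nonneg.mpr ht), smul_eq_mul] at h2
  nlinarith

end IsEvolution

/-- The solution operator of the evolution equation. -/
theorem exists_solutionOperator (hι : Function.Injective ι) (hd : DenseRange ι)
    (hι1 : ∀ v, ‖ι v‖ ≤ ‖v‖) (hκ : 0 < κ) (ht : t₀ ≤ t₁) (ha : ContinuousOn a (Icc t₀ t₁))
    (hco : ∀ t ∈ Icc t₀ t₁, ∀ v, ⟪a t v, v⟫_ℝ = κ * (‖v‖ ^ 2 - ‖ι v‖ ^ 2)) :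
    ∃ P : H →L[ℝ] H, ∀ u₀ u U, IsEvolution ι a t₀ t₁ u₀ u U → u t₁ = P u₀ := by
  choose u U hu₀ hu using exists_isEvolution hι hd ht hκ ha hco
  -- The difference of two solutions starts from zero. Uniqueness also yields the linearity of `P`.
  have huniq {u₀ : H} {v w : ℝ → H} {U W : ℝ → V} (hv : IsEvolution ι a t₀ t₁ u₀ v U)
      (hw : IsEvolution ι a t₀ t₁ u₀ w W) : v t₁ = w t₁ := by
    have h1 := (hv.add ha (hw.smul (-1))).norm_le hι hd hι1 hκ ha hco (right_mem_Icc.mpr ht)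
    simpa [← sub_eq_add_neg, sub_eq_zero] using h1
  let P : H →ₗ[ℝ] H :=
    { toFun := fun u₀ => u u₀ t₁
      map_add' := fun x y => huniq (hu (x + y)) ((hu x).add ha (hu y))
      map_smul' := fun c x => huniq (hu (c • x)) ((hu x).smul c) }
  refine ⟨P.mkContinuous 1 fun x => ?_, fun u₀ v W hv => huniq hv (hu u₀)⟩
  rw [one_mul]
  exact (hu x).norm_le hι hd hι1 hκ ha hco (right_mem_Icc.mpr ht)

end SolutionOperator

end FokkerPlanck

namespace FokkerPlanck
open ContinuousLinearMap Filter
open scoped InnerProductSpace Topology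

/-! ### Operators associated with bilinear forms. -/

section FormOperator

variable {H V ι : Type*} [NormedAddCommGroup H] [InnerProductSpace ℝ H] [CompleteSpace H]
  [NormedAddCommGroup V] [InnerProductSpace ℝ V] [CompleteSpace V] [Fintype ι]

/-- The operator of the bilinear form `κ ∑ i, ⟪D i U, D i W⟫ - ⟪J U, B W⟫`. -/
noncomputable def formOperator (κ : ℝ) (D : ι → V →L[ℝ] H) (J B : V →L[ℝ] H) : V →L[ℝ] V :=
  κ • (∑ i, adjoint (D i) ∘L D i) - adjoint B ∘L J

theorem inner_formOperator (κ : ℝ) (D : ι → V →L[ℝ] H) (J B : V →L[ℝ] H) (U W : V) :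
    ⟪formOperator κ D J B U, W⟫_ℝ = κ * ∑ i, ⟪D i U, D i W⟫_ℝ - ⟪J U, B W⟫_ℝ := by
  simp only [formOperator, sub_apply, smul_apply, sum_apply, comp_apply, inner_sub_left,
    inner_smul_left, sum_inner, adjoint_inner_left, conj_trivial]

theorem continuous_formOperator (κ : ℝ) (D : ι → V →L[ℝ] H) (J : V →L[ℝ] H) :
    Continuous (formOperator κ D J) :=
  continuous_const.sub
    ((adjoint (𝕜 := ℝ) (E := V) (F := H)).continuous.clm_comp continuous_const)

end FormOperator

/-! ### The Fokker–Planck form and its cancellations. -/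

section Generator

variable {d : ℕ} {lo hi : Fin d → ℝ} {bc : BoundaryCondition} {t₀ t₁ κ : ℝ}
  {b : ℝ → (Fin d → ℝ) → (Fin d → ℝ)}

open Classical in
/-- The class in `L^∞` of an essentially bounded function. -/
noncomputable def toLinf (lo hi : Fin d → ℝ) (v : (Fin d → ℝ) → ℝ) : Lp ℝ ⊤ (boxMeasure lo hi) :=
  -- For an admissible field the default is not reached at times in `[t₀, t₁]`, where the slices are
  -- continuous on the box.
  if h : MemLp v ⊤ (boxMeasure lo hi) then h.toLp else 0

theorem memLp_top_of_continuousOn {v : (Fin d → ℝ) → ℝ} (hv : ContinuousOn v (Icc lo hi)) :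
    MemLp v ⊤ (boxMeasure lo hi) := by
  obtain ⟨C, hC⟩ := isCompact_Icc.exists_bound_of_continuousOn hv
  refine memLp_top_of_bound (hv.aestronglyMeasurable measurableSet_Icc) C ?_
  filter_upwards [ae_restrict_mem measurableSet_Icc] with x hx using hC x hx

theorem coeFn_toLinf {v : (Fin d → ℝ) → ℝ} (hv : ContinuousOn v (Icc lo hi)) :
    toLinf lo hi v =ᵐ[boxMeasure lo hi] v := by
  rw [toLinf, dif_pos (memLp_top_of_continuousOn hv)]
  exact MemLp.coeFn_toLp _

/-- Multiplication of square integrable functions by essentially bounded functions. -/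
noncomputable def mulLinf (lo hi : Fin d → ℝ) :
    Lp ℝ ⊤ (boxMeasure lo hi) →L[ℝ] L2 lo hi →L[ℝ] L2 lo hi :=
  (ContinuousLinearMap.mul ℝ ℝ).holderL (boxMeasure lo hi) ⊤ 2 2

theorem coeFn_mulLinf (v : Lp ℝ ⊤ (boxMeasure lo hi)) (u : L2 lo hi) :
    mulLinf lo hi v u =ᵐ[boxMeasure lo hi] fun x => v x * u x :=
  (ContinuousLinearMap.mul ℝ ℝ).coeFn_holder v u

/-- Uniform continuity of `b` on a compact set makes its slices continuous in time for the sup norm;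
hence the generator is continuous in operator norm. -/
theorem continuousOn_toLinf
    (hb : ContinuousOn (Function.uncurry b) (Icc t₀ t₁ ×ˢ Icc lo hi)) (i : Fin d) :
    ContinuousOn (fun s => toLinf lo hi fun x => b s x i) (Icc t₀ t₁) := by
  have hsl {s : ℝ} (hs : s ∈ Icc t₀ t₁) : ContinuousOn (fun x => b s x i) (Icc lo hi) :=
    (continuous_apply i).comp_continuousOn
      (hb.comp (f := fun x => (s, x)) (by fun_prop) fun x hx => ⟨hs, hx⟩)
  have huc := (isCompact_Icc.prod isCompact_Icc).uniformContinuousOn_of_continuous hb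
  rw [Metric.uniformContinuousOn_iff] at huc
  rw [Metric.continuousOn_iff]
  intro s hs ε hε
  obtain ⟨δ, hδ, h⟩ := huc (ε / 2) (half_pos hε)
  refine ⟨δ, hδ, fun r hr hrs => ?_⟩
  rw [dist_eq_norm]
  refine lt_of_le_of_lt ?_ (half_lt_self hε)
  have := Lp.norm_le_of_ae_bound (f := (toLinf lo hi fun x => b r x i) -
    toLinf lo hi fun x => b s x i) (C := ε / 2) (half_pos hε).le (by
      filter_upwards [Lp.coeFn_sub (toLinf lo hi fun x => b r x i) (toLinf lo hi fun x => b s x i),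
        coeFn_toLinf (hsl hr), coeFn_toLinf (hsl hs), ae_restrict_mem measurableSet_Icc]
        with x h1 h2 h3 h4
      rw [h1, Pi.sub_apply, h2, h3, ← dist_eq_norm]
      have h5 := h (r, x) ⟨hr, h4⟩ (s, x) ⟨hs, h4⟩ (by simpa [Prod.dist_eq] using hrs)
      exact (dist_le_pi_dist (b r x) (b s x) i).trans h5.le)
  simpa using this

/-- The drift `U ↦ b(s) · ∇U`. -/
noncomputable def drift (lo hi : Fin d → ℝ) (bc : BoundaryCondition)
    (b : ℝ → (Fin d → ℝ) → (Fin d → ℝ)) (s : ℝ) : sobolev lo hi bc →L[ℝ] L2 lo hi :=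
  ∑ i, mulLinf lo hi (toLinf lo hi fun x => b s x i) ∘L grad lo hi bc i

theorem continuousOn_drift
    (hb : ContinuousOn (Function.uncurry b) (Icc t₀ t₁ ×ˢ Icc lo hi)) :
    ContinuousOn (drift lo hi bc b) (Icc t₀ t₁) := by
  refine continuousOn_finsetSum _ fun i _ => ?_
  exact ((mulLinf lo hi).continuous.comp_continuousOn (continuousOn_toLinf hb i)).clm_comp
    continuousOn_const

/-- The operator of the form `κ ⟪∇U, ∇W⟫ - ⟪U, b(s) · ∇W⟫` on the Sobolev space. -/
noncomputable def generator (lo hi : Fin d → ℝ) (bc : BoundaryCondition) (κ : ℝ)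
    (b : ℝ → (Fin d → ℝ) → (Fin d → ℝ)) (s : ℝ) : sobolev lo hi bc →L[ℝ] sobolev lo hi bc :=
  formOperator κ (grad lo hi bc) (embed lo hi bc) (drift lo hi bc b s)

theorem inner_generator (s : ℝ) (U W : sobolev lo hi bc) :
    ⟪generator lo hi bc κ b s U, W⟫_ℝ =
      κ * ∑ i, ⟪grad lo hi bc i U, grad lo hi bc i W⟫_ℝ -
        ⟪embed lo hi bc U, drift lo hi bc b s W⟫_ℝ :=
  inner_formOperator _ _ _ _ U W

theorem continuousOn_generator
    (hb : ContinuousOn (Function.uncurry b) (Icc t₀ t₁ ×ˢ Icc lo hi)) :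
    ContinuousOn (generator lo hi bc κ b) (Icc t₀ t₁) :=
  (continuous_formOperator _ _ _).comp_continuousOn (continuousOn_drift hb)

theorem IsAdmissibleField.continuousOn_slice (hb : IsAdmissibleField lo hi bc t₀ t₁ b) {s : ℝ}
    (hs : s ∈ Icc t₀ t₁) (i : Fin d) : ContinuousOn (fun x => b s x i) (Icc lo hi) :=
  (continuous_apply i).comp_continuousOn (hb.locallyLipschitzOn s hs).continuousOn

theorem inner_drift_jet (hb : IsAdmissibleField lo hi bc t₀ t₁ b) {s : ℝ} (hs : s ∈ Icc t₀ t₁)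
    (u : L2 lo hi) {φ : (Fin d → ℝ) → ℝ} (hφ : IsTestFunction lo hi bc φ) :
    ⟪u, drift lo hi bc b s hφ.jet⟫_ℝ =
      ∫ x in Icc lo hi, u x * ∑ i, b s x i * partialDeriv i φ x := by
  have h1 : drift lo hi bc b s hφ.jet =ᵐ[boxMeasure lo hi]
      fun x => ∑ i, b s x i * partialDeriv i φ x := by
    have h2 : drift lo hi bc b s hφ.jet = ∑ i, mulLinf lo hi (toLinf lo hi fun x => b s x i)
        (toL2 lo hi (continuous_partialDeriv hφ.contDiff_one i)) := by
      simp [drift, sum_apply, IsTestFunction.grad_jet]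
    rw [h2]
    refine (Lp.coeFn_finsetSum _ _).trans ?_
    have h3 : ∀ᵐ x ∂(boxMeasure lo hi), ∀ i, mulLinf lo hi (toLinf lo hi fun x => b s x i)
        (toL2 lo hi (continuous_partialDeriv hφ.contDiff_one i)) x =
          b s x i * partialDeriv i φ x := by
      refine ae_all_iff.mpr fun i => ?_
      filter_upwards [coeFn_mulLinf (toLinf lo hi fun x => b s x i)
        (toL2 lo hi (continuous_partialDeriv hφ.contDiff_one i)),
        coeFn_toLinf (hb.continuousOn_slice hs i),
        coeFn_toL2 (continuous_partialDeriv hφ.contDiff_one i)] with x h4 h5 h6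
      rw [h4, h5, h6]
    filter_upwards [h3] with x hx
    simp [Finset.sum_apply, hx]
  rw [L2.inner_def]
  refine integral_congr_ae ?_
  filter_upwards [h1] with x hx
  rw [hx]
  simp [mul_comm]

theorem toL2_one : toL2 lo hi (continuous_const (y := (1 : ℝ))) = one lo hi := by
  refine Lp.ext ((coeFn_toL2 _).trans ?_)
  exact (Lp.coeFn_const 2 (boxMeasure lo hi) (1 : ℝ)).symm

/-- The constant function `1` as an element of the Sobolev space. -/
noncomputable def jetOne (lo hi : Fin d → ℝ) (bc : BoundaryCondition) : sobolev lo hi bc :=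
  (isTestFunction_const 1 : IsTestFunction lo hi bc fun _ => 1).jet

theorem embed_jetOne : embed lo hi bc (jetOne lo hi bc) = one lo hi := toL2_one

theorem grad_jetOne (i : Fin d) : grad lo hi bc i (jetOne lo hi bc) = 0 := by
  rw [jetOne, IsTestFunction.grad_jet]
  refine Lp.ext ((coeFn_toL2 _).trans (EventuallyEq.trans ?_ (Lp.coeFn_zero _ _ _).symm))
  exact Eventually.of_forall fun x => by simp [partialDeriv]

theorem drift_jetOne (s : ℝ) : drift lo hi bc b s (jetOne lo hi bc) = 0 := by
  simp [drift, sum_apply, grad_jetOne]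

/-- Incompressibility, extended from test functions by density; it makes the constants stationary.
-/
theorem inner_one_drift (hle : ∀ i, lo i ≤ hi i) (hb : IsAdmissibleField lo hi bc t₀ t₁ b) {s : ℝ}
    (hs : s ∈ Icc t₀ t₁) (W : sobolev lo hi bc) :
    ⟪one lo hi, drift lo hi bc b s W⟫_ℝ = 0 := by
  refine sobolev_induction (p := fun W => ⟪one lo hi, drift lo hi bc b s W⟫_ℝ = 0)
    (isClosed_eq (by fun_prop) continuous_const) (fun φ hφ => ?_) W
  rw [inner_drift_jet hb hs, ← integral_sum_mul_partialDeriv_eq_zero hle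
    (hb.locallyLipschitzOn s hs) (hb.div_eq_zero s hs) (hb.boundary s hs) hφ]
  refine integral_congr_ae ?_
  filter_upwards [Lp.coeFn_const 2 (boxMeasure lo hi) (1 : ℝ)] with x hx
  rw [one, hx, Function.const_apply, one_mul]

/-- For a test function `2 φ b · ∇φ = b · ∇(φ²)`, and `φ²` is again a test function. This
cancellation leaves only diffusion in the energy. -/
theorem inner_embed_drift_self (hle : ∀ i, lo i ≤ hi i)
    (hb : IsAdmissibleField lo hi bc t₀ t₁ b) {s : ℝ} (hs : s ∈ Icc t₀ t₁)
    (U : sobolev lo hi bc) : ⟪embed lo hi bc U, drift lo hi bc b s U⟫_ℝ = 0 := by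
  refine sobolev_induction (p := fun U => ⟪embed lo hi bc U, drift lo hi bc b s U⟫_ℝ = 0)
    (isClosed_eq (by fun_prop) continuous_const) (fun φ hφ => ?_) U
  have h1 := integral_sum_mul_partialDeriv_eq_zero hle
    (hb.locallyLipschitzOn s hs) (hb.div_eq_zero s hs) (hb.boundary s hs) (hφ.mul hφ)
  rw [inner_drift_jet hb hs, ← mul_right_inj' (two_ne_zero' ℝ), mul_zero, ← h1,
    ← integral_const_mul]
  refine integral_congr_ae ?_
  filter_upwards [coeFn_toL2 hφ.contDiff.continuous] with x hx
  rw [IsTestFunction.embed_jet, hx, Finset.mul_sum, Finset.mul_sum]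
  refine Finset.sum_congr rfl fun i _ => ?_
  have h2 : partialDeriv i (φ * φ) x = 2 * (φ x * partialDeriv i φ x) := by
    simp only [partialDeriv]
    rw [fderiv_mul (hφ.differentiable x) (hφ.differentiable x)]
    simp; ring
  rw [h2]; ring

theorem inner_generator_self (hle : ∀ i, lo i ≤ hi i) (hb : IsAdmissibleField lo hi bc t₀ t₁ b) :
    ∀ t ∈ Icc t₀ t₁, ∀ U, ⟪generator lo hi bc κ b t U, U⟫_ℝ =
      κ * (‖U‖ ^ 2 - ‖embed lo hi bc U‖ ^ 2) := by
  intro t ht U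
  rw [inner_generator, inner_embed_drift_self hle hb ht, norm_sq_sobolev, add_sub_cancel_left,
    sub_zero]
  simp only [real_inner_self_eq_norm_sq]

theorem generator_jetOne (hle : ∀ i, lo i ≤ hi i) (hb : IsAdmissibleField lo hi bc t₀ t₁ b) {s : ℝ}
    (hs : s ∈ Icc t₀ t₁) : generator lo hi bc κ b s (jetOne lo hi bc) = 0 := by
  refine ext_inner_right ℝ fun W => ?_
  rw [inner_generator, embed_jetOne, inner_one_drift hle hb hs]
  simp [grad_jetOne]

theorem norm_embed_le (U : sobolev lo hi bc) : ‖embed lo hi bc U‖ ≤ ‖U‖ := by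
  refine le_of_sq_le_sq ?_ (norm_nonneg _)
  rw [norm_sq_sobolev U]
  exact le_add_of_nonneg_right (Finset.sum_nonneg fun i _ => sq_nonneg _)

/-- The Poincaré inequality on the Sobolev space. -/
theorem exists_poincare (lo hi : Fin d → ℝ) (bc : BoundaryCondition) : ∃ C : ℝ, 0 < C ∧
    ∀ U : sobolev lo hi bc, (volume (Icc lo hi)).toReal * ‖embed lo hi bc U‖ ^ 2 -
      ⟪embed lo hi bc U, one lo hi⟫_ℝ ^ 2 ≤ C * (‖U‖ ^ 2 - ‖embed lo hi bc U‖ ^ 2) := by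
  obtain ⟨C, hC, h⟩ := variance_le_of_contDiff lo hi
  refine ⟨C, hC, fun U => ?_⟩
  refine sobolev_induction (p := fun U => (volume (Icc lo hi)).toReal * ‖embed lo hi bc U‖ ^ 2 -
      ⟪embed lo hi bc U, one lo hi⟫_ℝ ^ 2 ≤ C * (‖U‖ ^ 2 - ‖embed lo hi bc U‖ ^ 2))
    (isClosed_le (by fun_prop) (by fun_prop)) (fun φ hφ => ?_) U
  have h1 := h φ hφ.contDiff_one
  rw [norm_sq_sobolev, add_sub_cancel_left, ← toL2_one, IsTestFunction.embed_jet,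
    inner_toL2_toL2]
  simp only [← real_inner_self_eq_norm_sq, IsTestFunction.grad_jet, inner_toL2_toL2, mul_one]
  simpa only [sq] using h1

end Generator

end FokkerPlanck

namespace FokkerPlanck
open ContinuousLinearMap Filter
open scoped InnerProductSpace Topology

/-! ### Weak solutions as abstract evolutions, and the gap of the transfer operator. -/

section WeakSolution

variable {d : ℕ} {lo hi : Fin d → ℝ} {bc : BoundaryCondition} {t₀ t₁ ε : ℝ}
  {b : ℝ → (Fin d → ℝ) → (Fin d → ℝ)}

theorem weakForm_eq_neg_inner_generator (hb : IsAdmissibleField lo hi bc t₀ t₁ b) {s : ℝ}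
    (hs : s ∈ Icc t₀ t₁) (κ : ℝ) (U : sobolev lo hi bc) {φ : (Fin d → ℝ) → ℝ}
    (hφ : IsTestFunction lo hi bc φ) :
    -κ * (∑ i, ∫ x in Icc lo hi, grad lo hi bc i U x * partialDeriv i φ x) +
      ∫ x in Icc lo hi, embed lo hi bc U x * ∑ i, b s x i * partialDeriv i φ x =
    -⟪generator lo hi bc κ b s U, hφ.jet⟫_ℝ := by
  rw [inner_generator, inner_drift_jet hb hs]
  simp only [IsTestFunction.grad_jet, inner_toL2]
  ring

theorem inner_interval_integral {E : Type*} [NormedAddCommGroup E] [InnerProductSpace ℝ E]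
    [CompleteSpace E] {f : ℝ → E} {a c : ℝ} (hf : IntervalIntegrable f volume a c) (w : E) :
    ⟪∫ s in a..c, f s, w⟫_ℝ = ∫ s in a..c, ⟪f s, w⟫_ℝ := by
  rw [real_inner_comm]
  have := (innerSL ℝ w).intervalIntegral_comp_comm hf
  simp only [innerSL_apply_apply] at this
  rw [← this]
  simp_rw [real_inner_comm]

/-- Evolutions of the generator are weak solutions. -/
theorem IsEvolution.isWeakSolution (hb : IsAdmissibleField lo hi bc t₀ t₁ b) {u₀ : L2 lo hi}
    {u : ℝ → L2 lo hi} {U : ℝ → sobolev lo hi bc} (hu₀ : u t₀ = u₀)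
    (h : IsEvolution (embed lo hi bc) (generator lo hi bc (ε ^ 2 / 2) b) t₀ t₁ u₀ u U) :
    IsWeakSolution lo hi bc t₀ t₁ ε b u₀ u := by
  have ha := continuousOn_generator (κ := ε ^ 2 / 2) (bc := bc) hb.continuousOn
  refine ⟨h.continuousOn, hu₀, fun s i => grad lo hi bc i (U s),
    fun i => (grad lo hi bc i).comp_memLp' h.memLp, ?_, fun φ hφ t ht => ?_⟩
  · filter_upwards [h.ae_eq] with s hs
    rw [hs]
    exact hasSobolevGradient_embed (U s)
  · have h1 := congrArg (fun v => ⟪v, hφ.jet⟫_ℝ) (h.eq_integral t ht)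
    simp only [inner_sub_left, adjoint_inner_left, IsTestFunction.embed_jet, inner_toL2] at h1
    rw [inner_interval_integral (intervalIntegrable_of_memLp (memLp_clm_apply ha h.memLp) ht)] at h1
    rw [h1, sub_eq_add_neg, ← intervalIntegral.integral_neg]
    congr 1
    refine intervalIntegral.integral_congr_ae ?_
    filter_upwards [ae_uIoc_of_ae_restrict h.ae_eq ht] with s hs hst
    rw [hs hst]
    rw [uIoc_of_le ht.1] at hst
    exact (weakForm_eq_neg_inner_generator hb ⟨hst.1.le, hst.2.trans ht.2⟩ _ (U s) hφ).symm

open Classical in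
/-- Weak solutions are evolutions of the generator. -/
theorem IsWeakSolution.exists_isEvolution (hb : IsAdmissibleField lo hi bc t₀ t₁ b)
    {u₀ : L2 lo hi} {u : ℝ → L2 lo hi} (h : IsWeakSolution lo hi bc t₀ t₁ ε b u₀ u) :
    ∃ U, IsEvolution (embed lo hi bc) (generator lo hi bc (ε ^ 2 / 2) b) t₀ t₁ u₀ u U := by
  obtain ⟨hc, -, g, hg2, hgrad, hweak⟩ := h
  have ha := continuousOn_generator (κ := ε ^ 2 / 2) (bc := bc) hb.continuousOn
  let U (s : ℝ) : sobolev lo hi bc :=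
    if h : HasSobolevGradient lo hi bc (u s) (g s) then ⟨Jet.pack (u s, g s), h.pack_mem⟩ else 0
  have hU : ∀ᵐ s ∂(volume.restrict (Icc t₀ t₁)),
      (U s : Jet lo hi) = Jet.pack (u s, g s) := by
    filter_upwards [hgrad] with s hs
    simp only [U, dif_pos hs]
  have hUu : ∀ᵐ s ∂(volume.restrict (Icc t₀ t₁)), embed lo hi bc (U s) = u s ∧
      ∀ i, grad lo hi bc i (U s) = g s i := by
    filter_upwards [hgrad] with s hs
    simp only [U, dif_pos hs]
    exact ⟨rfl, fun _ => rfl⟩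
  have hu2 : MemLp u 2 (volume.restrict (Icc t₀ t₁)) := memLp_of_continuousOn hc
  have hUm : AEStronglyMeasurable U (volume.restrict (Icc t₀ t₁)) := by
    -- Measurability is checked in the ambient jet space, where `U` is almost everywhere assembled
    -- from the measurable `u` and `g`.
    rw [← Topology.IsEmbedding.subtypeVal.aestronglyMeasurable_comp_iff]
    refine AEStronglyMeasurable.congr ?_ (hU.mono fun s hs => hs.symm)
    refine Jet.continuous_pack.comp_aestronglyMeasurable (hu2.aestronglyMeasurable.prodMk ?_)
    have h1 : g = fun s => ∑ i, Pi.single (M := fun _ => L2 lo hi) i (g s i) :=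
      funext fun s => (Finset.univ_sum_single (g s)).symm
    rw [h1]
    exact Finset.aestronglyMeasurable_fun_sum _ fun i _ =>
      (continuous_single i).comp_aestronglyMeasurable (hg2 i).aestronglyMeasurable
  have hU2 : MemLp U 2 (volume.restrict (Icc t₀ t₁)) := by
    rw [memLp_two_iff_integrable_sq_norm hUm]
    have h1 : Integrable (fun s => ‖u s‖ ^ 2 + ∑ i, ‖g s i‖ ^ 2) (volume.restrict (Icc t₀ t₁)) :=
      (hu2.integrable_norm_pow two_ne_zero).add
        (integrable_finsetSum _ fun i _ => (hg2 i).integrable_norm_pow two_ne_zero)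
    refine h1.congr ?_
    filter_upwards [hUu] with s hs
    rw [norm_sq_sobolev, hs.1]
    simp only [hs.2]
  refine ⟨U, hc, hU2, hUu.mono fun s hs => hs.1.symm, fun t ht => ?_⟩
  have hFi := intervalIntegrable_of_memLp (memLp_clm_apply ha hU2) ht
  refine ext_inner_right ℝ fun W => ?_
  -- The identity in `V` need only be tested on the dense set of test functions, where it is the
  -- weak formulation.
  refine sobolev_induction (p := fun W => ⟪adjoint (embed lo hi bc) (u t), W⟫_ℝ =
    ⟪adjoint (embed lo hi bc) u₀ -
      ∫ s in t₀..t, generator lo hi bc (ε ^ 2 / 2) b s (U s), W⟫_ℝ)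
    (isClosed_eq (by fun_prop) (by fun_prop)) (fun φ hφ => ?_) W
  rw [inner_sub_left, inner_interval_integral hFi]
  simp only [adjoint_inner_left, IsTestFunction.embed_jet, inner_toL2]
  rw [hweak φ hφ t ht, sub_eq_add_neg, ← intervalIntegral.integral_neg]
  congr 1
  refine intervalIntegral.integral_congr_ae ?_
  filter_upwards [ae_uIoc_of_ae_restrict hUu ht] with s hs hst
  have h2 := hs hst
  rw [uIoc_of_le ht.1] at hst
  rw [← weakForm_eq_neg_inner_generator hb ⟨hst.1.le, hst.2.trans ht.2⟩ _ (U s) hφ, h2.1]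
  simp only [h2.2]

/-- Weak solutions conserve mass. -/
theorem IsEvolution.inner_one_eq (hb : IsAdmissibleField lo hi bc t₀ t₁ b) {κ : ℝ}
    {u₀ : L2 lo hi} {u : ℝ → L2 lo hi} {U : ℝ → sobolev lo hi bc}
    (h : IsEvolution (embed lo hi bc) (generator lo hi bc κ b) t₀ t₁ u₀ u U) {t : ℝ}
    (ht : t ∈ Icc t₀ t₁) : ⟪u t, one lo hi⟫_ℝ = ⟪u₀, one lo hi⟫_ℝ := by
  have ha := continuousOn_generator (κ := κ) (bc := bc) hb.continuousOn
  have h1 := congrArg (fun v => ⟪v, jetOne lo hi bc⟫_ℝ) (h.eq_integral t ht)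
  simp only [inner_sub_left, adjoint_inner_left, embed_jetOne] at h1
  rw [inner_interval_integral (intervalIntegrable_of_memLp (memLp_clm_apply ha h.memLp) ht)] at h1
  simp only [inner_generator, grad_jetOne, drift_jetOne, inner_zero_right, Finset.sum_const_zero,
    mul_zero, sub_zero, intervalIntegral.integral_zero] at h1
  exact h1

theorem isEvolution_one (hle : ∀ i, lo i ≤ hi i) (hb : IsAdmissibleField lo hi bc t₀ t₁ b)
    (κ : ℝ) : IsEvolution (embed lo hi bc) (generator lo hi bc κ b) t₀ t₁ (one lo hi)
      (fun _ => one lo hi) (fun _ => jetOne lo hi bc) where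
  continuousOn := continuousOn_const
  memLp := memLp_const _
  ae_eq := Eventually.of_forall fun _ => embed_jetOne.symm
  eq_integral t ht := by
    rw [intervalIntegral.integral_congr (g := fun _ => 0)]
    · simp
    · intro s hs
      rw [uIcc_of_le ht.1] at hs
      exact generator_jetOne hle hb ⟨hs.1, hs.2.trans ht.2⟩

theorem measure_box_pos (hX : ∀ i, lo i < hi i) : 0 < (volume (Icc lo hi)).toReal := by
  rw [Real.volume_Icc_pi_toReal (fun i => (hX i).le)]
  exact Finset.prod_pos fun i _ => sub_pos.mpr (hX i)

theorem constOne_ne_zero (hX : ∀ i, lo i < hi i) : one lo hi ≠ 0 := by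
  intro h
  have h1 : ⟪one lo hi, one lo hi⟫_ℝ = (volume (Icc lo hi)).toReal := by
    rw [← toL2_one, inner_toL2_toL2]
    simp [measureReal_def]
  rw [h, inner_zero_left] at h1
  exact (measure_box_pos hX).ne h1

/-- Contraction of weak solutions with zero mean, uniformly in the initial value. -/
theorem exists_contraction (hX : ∀ i, lo i < hi i) (ht : t₀ < t₁) (hε : 0 < ε)
    (hb : IsAdmissibleField lo hi bc t₀ t₁ b) : ∃ q : ℝ, 0 ≤ q ∧ q < 1 ∧
    ∀ u₀ u U, IsEvolution (embed lo hi bc) (generator lo hi bc (ε ^ 2 / 2) b) t₀ t₁ u₀ u U →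
      ⟪one lo hi, u₀⟫_ℝ = 0 → ‖u t₁‖ ≤ q * ‖u₀‖ := by
  have hle : ∀ i, lo i ≤ hi i := fun i => (hX i).le
  obtain ⟨C, hC, hP⟩ := exists_poincare lo hi bc
  set m := (volume (Icc lo hi)).toReal with hm
  have hm0 : 0 < m := measure_box_pos hX
  have hκ : 0 < ε ^ 2 / 2 := by positivity
  -- The decay factor of `norm_sq_mul_le` with `κ = ε²/2` and Poincaré constant `m / C`; the
  -- contraction rate is `1/√M`.
  set M := 1 + 2 * (ε ^ 2 / 2) * (m / C) * (t₁ - t₀) with hM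
  have hM1 : 1 < M := by
    have := mul_pos (mul_pos (mul_pos two_pos hκ) (div_pos hm0 hC)) (sub_pos.mpr ht)
    linarith
  have hM0 : 0 < M := zero_lt_one.trans hM1
  refine ⟨√M⁻¹, Real.sqrt_nonneg _, ?_, fun u₀ u U h h0 => ?_⟩
  · rw [Real.sqrt_lt' one_pos, one_pow]
    exact inv_lt_one_of_one_lt₀ hM1
  have h1 := h.norm_sq_mul_le embed_injective (denseRange_embed hX) norm_embed_le hκ ht.le
    (continuousOn_generator hb.continuousOn) (inner_generator_self hle hb)
    (div_nonneg hm0.le hC.le) (by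
      filter_upwards [h.ae_eq, ae_restrict_mem measurableSet_Icc] with s h2 h3
      have h4 := hP (U s)
      -- Conservation of mass keeps the mean zero, which removes the mean term from the Poincaré
      -- inequality.
      rw [← h2, h.inner_one_eq hb h3, real_inner_comm, h0] at h4
      rw [← h2, div_mul_eq_mul_div, div_le_iff₀ hC]
      linarith)
  refine le_of_sq_le_sq ?_ (by positivity)
  rw [mul_pow, Real.sq_sqrt (by positivity), inv_mul_eq_div, le_div_iff₀ hM0, mul_comm]
  exact h1

theorem exists_isTransferOperator (hX : ∀ i, lo i < hi i) (ht : t₀ < t₁) (hε : 0 < ε)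
    (hb : IsAdmissibleField lo hi bc t₀ t₁ b) :
    ∃ P : L2 lo hi →L[ℝ] L2 lo hi, IsTransferOperator lo hi bc t₀ t₁ ε b P := by
  have hle : ∀ i, lo i ≤ hi i := fun i => (hX i).le
  have hκ : 0 < ε ^ 2 / 2 := by positivity
  have ha := continuousOn_generator (κ := ε ^ 2 / 2) (bc := bc) hb.continuousOn
  obtain ⟨P, hP⟩ := exists_solutionOperator embed_injective (denseRange_embed hX) norm_embed_le
    hκ ht.le ha (inner_generator_self hle hb)
  refine ⟨P, fun u₀ => ⟨?_, fun u hu => ?_⟩⟩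
  · obtain ⟨u, U, h0, h⟩ := FokkerPlanck.exists_isEvolution embed_injective (denseRange_embed hX)
      ht.le hκ ha (inner_generator_self hle hb) u₀
    exact ⟨u, h.isWeakSolution hb h0⟩
  · obtain ⟨U, hU⟩ := hu.exists_isEvolution hb
    exact hP u₀ u U hU

/-- `P 1 = 1` is stationarity of constants, `P* 1 = 1` is conservation of mass, and the contraction
comes from `exists_contraction`. -/
theorem IsTransferOperator.isGapped (hX : ∀ i, lo i < hi i) (ht : t₀ < t₁) (hε : 0 < ε)
    (hb : IsAdmissibleField lo hi bc t₀ t₁ b) {P : L2 lo hi →L[ℝ] L2 lo hi}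
    (hP : IsTransferOperator lo hi bc t₀ t₁ ε b P) : ∃ q, IsGapped P (one lo hi) q := by
  have hle : ∀ i, lo i ≤ hi i := fun i => (hX i).le
  obtain ⟨q, hq0, hq1, hq⟩ := exists_contraction hX ht hε hb
  have hsol (u₀ : L2 lo hi) : ∃ u U, u t₁ = P u₀ ∧ IsEvolution (embed lo hi bc)
      (generator lo hi bc (ε ^ 2 / 2) b) t₀ t₁ u₀ u U := by
    obtain ⟨⟨u, hu⟩, h⟩ := hP u₀
    obtain ⟨U, hU⟩ := hu.exists_isEvolution hb
    exact ⟨u, U, h u hu, hU⟩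
  refine ⟨q, constOne_ne_zero hX, ?_, ?_, hq0, hq1, fun v hv => ?_⟩
  · have h1 : IsWeakSolution lo hi bc t₀ t₁ ε b (one lo hi) (fun _ => one lo hi) :=
      IsEvolution.isWeakSolution hb rfl (isEvolution_one hle hb (ε ^ 2 / 2))
    exact ((hP _).2 _ h1).symm
  · refine ext_inner_right ℝ fun u₀ => ?_
    obtain ⟨u, U, hu, hU⟩ := hsol u₀
    rw [adjoint_inner_left, ← hu, real_inner_comm, hU.inner_one_eq hb (right_mem_Icc.mpr ht.le),
      real_inner_comm]
  · obtain ⟨u, U, hu, hU⟩ := hsol v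
    rw [← hu]
    exact hq v u U hU hv

end WeakSolution

end FokkerPlanck

theorem lemma3 {d : ℕ} (lo hi : Fin d → ℝ) (hX : ∀ i, lo i < hi i)
    (t₀ t₁ ε : ℝ) (ht : t₀ < t₁) (hε : 0 < ε)
    (bc : FokkerPlanck.BoundaryCondition)
    (b : ℝ → (Fin d → ℝ) → (Fin d → ℝ))
    (hb : FokkerPlanck.IsAdmissibleField lo hi bc t₀ t₁ b) :
    (∃! P : FokkerPlanck.L2 lo hi →L[ℝ] FokkerPlanck.L2 lo hi,
      FokkerPlanck.IsTransferOperator lo hi bc t₀ t₁ ε b P) ∧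
    ∀ P : FokkerPlanck.L2 lo hi →L[ℝ] FokkerPlanck.L2 lo hi,
      FokkerPlanck.IsTransferOperator lo hi bc t₀ t₁ ε b P →
      -- `σ₁ = 1` is the largest singular value and is isolated among the singular values
      FokkerPlanck.IsSingularValue P 1 ∧
      (∀ σ, FokkerPlanck.IsSingularValue P σ → σ ≤ 1) ∧
      (∃ δ > 0, ∀ σ, FokkerPlanck.IsSingularValue P σ → σ ≠ 1 → δ ≤ |σ - 1|) ∧
      -- `1` is the maximum and an isolated point of the spectrum of `P* P`
      IsGreatest (spectrum ℝ (ContinuousLinearMap.adjoint P ∘L P)) 1 ∧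
      (∃ δ > 0, ∀ μ ∈ spectrum ℝ (ContinuousLinearMap.adjoint P ∘L P),
        μ ≠ 1 → δ ≤ |μ - 1|) ∧
      -- the eigenvalue `1` of `P* P` is simple, with the constants as eigenfunctions
      Module.End.eigenspace (ContinuousLinearMap.adjoint P ∘L P).toLinearMap 1 =
        Submodule.span ℝ {FokkerPlanck.one lo hi} ∧
      Module.finrank ℝ
        (Module.End.eigenspace (ContinuousLinearMap.adjoint P ∘L P).toLinearMap 1) = 1 ∧
      -- the constants are the only eigenfunctions of `P` and of `P*` for the eigenvalue `1`
      Module.End.eigenspace P.toLinearMap 1 =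
        Submodule.span ℝ {FokkerPlanck.one lo hi} ∧
      Module.End.eigenspace (ContinuousLinearMap.adjoint P).toLinearMap 1 =
        Submodule.span ℝ {FokkerPlanck.one lo hi} ∧
      -- the `L²` norm strictly decreases for non-constant initial data
      (∀ u₀ : FokkerPlanck.L2 lo hi,
        u₀ ∉ Submodule.span ℝ {FokkerPlanck.one lo hi} → ‖P u₀‖ < ‖u₀‖) := by
  obtain ⟨P, hP⟩ := FokkerPlanck.exists_isTransferOperator hX ht hε hb
  refine ⟨⟨P, hP, fun Q hQ => ContinuousLinearMap.ext fun u₀ => ?_⟩, fun P hP => ?_⟩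
  -- Since each initial value has a weak solution, its final value determines the operator.
  · obtain ⟨⟨u, hu⟩, h⟩ := hP u₀
    exact ((hQ u₀).2 u hu).symm.trans (h u hu)
  obtain ⟨q, hg⟩ := hP.isGapped hX ht hε hb
  refine ⟨hg.isSingularValue_one, fun σ hσ => ?_, ⟨1 - q, sub_pos.2 hg.lt_one, fun σ hσ h1 => ?_⟩,
    hg.adjoint_comp_self.isGreatest_spectrum,
    ⟨1 - q ^ 2, sub_pos.2 hg.adjoint_comp_self.lt_one, hg.adjoint_comp_self.spectrum_gap⟩,
    hg.adjoint_comp_self.eigenspace_one, hg.adjoint_comp_self.finrank_eigenspace,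
    hg.eigenspace_one, hg.adjoint.eigenspace_one, fun u₀ hu => hg.norm_map_lt hu⟩
  · rcases hg.eq_one_or_le_of_isSingularValue hσ with h | h
    · exact h.le
    · exact h.trans hg.lt_one.le
  · have h := (hg.eq_one_or_le_of_isSingularValue hσ).resolve_left h1
    rw [abs_sub_comm]
    exact (sub_le_sub_left h 1).trans (le_abs_self _)
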